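/- Let $n\ge 2$ and $m\ge 0$ be integers, and for integers $l_1,\dots,l_m\ge 0$ let $B=B_1\otimes\cdots\otimes B_m$, where $B_i$ is the Kirillov–Reshetikhin crystal of $U_q'(\widehat{\mathfrak{sl}}_n)$ for the $l_i$-th symmetric power of the standard representation. The elements of $B_i$ are the single-row semistandard tableaux with $l_i$ boxes and letters in $\{1,\dots,n\}$, where $\{1,\dots,n\}$ is identified with $\mathbb Z/n\mathbb Z$. For $i\in\mathbb Z/n\mathbb Z$ the operator $f_i$ replaces a letter $i$ by $i+1$ and $e_i$ replaces a letter $i+1$ by $i$ (the result is $0$ if there is no such letter); $\varphi_i(b)$ and $\varepsilon_i(b)$ are the numbers of letters $i$ and $i+1$ in $b$. On $b\otimes b'$ the operator $e_i$ acts on the left factor if $\varphi_i(b')<\varepsilon_i(b)$ and on the right factor otherwise, and $f_i$ acts on the right factor if $\varepsilon_i(b)<\varphi_i(b')$ and on the left factor otherwise. The combinatorial $R$-matrix $R_{B,B'}:B\otimes B'\to B'\otimes B$ is the unique isomorphism of affine crystals. The local coenergy $H_{B,B'}:B\otimes B'\to\mathbb Z$ is the unique function that is invariant under $e_i$ for $i\ne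 0$, changes along $e_0$ by $+1$ (resp. $-1$) if $e_0$ acts on the left (resp. right) factor both of $b\otimes b'$ and of $R_{B,B'}(b\otimes b')$ and by $0$ otherwise, and vanishes at $1^{l}\otimes 1^{l'}$. (Equivalently, $H_{B,B'}(b\otimes b')$ is the largest number of cells by which the row $b'$, placed above and to the right of the row $b$, can be slid to the left over $b$ so that the tableau stays semistandard.) For $b=b_1\otimes\cdots\otimes b_m\in B$ and $i<j$ let $b_{i\to j-1}\in B_i$ be the factor in position $j-1$ after the $R$-matrix has been applied to $b$ in positions $(i,i+1)$, then $(i+1,i+2)$, $\dots$, finally $(j-2,j-1)$. The intrinsic energy is $$D_B(b)=\sum_{1\le i<j\le m}H_{B_i,B_j}(b_{i\to j-1}\otimes b_j).$$ Let $(n-1)\delta_{m-1}$ be the partition $\bigl((n-1)(m-1),(n-1)(m-2),\dots,n-1\bigr)$ (empty if $m\le 1$), and let $$s^{(0)}_{(n-1)\delta_{m-1}}(x_1,\dots,x_m)=\sum_T\ \prod_{(i,j)\in (n-1)\delta_{m-1}}x_{T(i,j)}^{(i-j)}$$ be the loop Schur function in the variables $x_i^{(s)}$, $1\le i\le m$,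 $s\in\mathbb Z/n\mathbb Z$, where $T$ runs over the semistandard tableaux of shape $(n-1)\delta_{m-1}$ with entries in $\{1,\dots,m\}$, $(i,j)$ is the square in row $i$ and column $j$, and upper indices are read in $\mathbb Z/n\mathbb Z$. Then $D_B$ is the tropicalization of $s^{(0)}_{(n-1)\delta_{m-1}}$: for every $b\in B$, the value $D_B(b)$ is obtained from this polynomial by replacing multiplication by addition, addition by minimum, and each variable $x_i^{(s)}$ by the number of letters congruent to $s+1-i$ modulo $n$ in $b_i$. -/

import Mathlib

/-! ### Row crystals and their tensor products

The letters `1, …, n` are identified with the residues in `ZMod n` (so the letter `n` is `0`). -/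

/-- The Kirillov-Reshetikhin crystal of the `l`-th symmetric power of the standard representation:
a single-row semistandard tableau with `l` boxes is recorded by the number `b r` of letters `r`. -/
def KRRow (n : ℕ) [NeZero n] (l : ℕ) : Type :=
  {y : ZMod n → ℕ // ∑ r, y r = l}

namespace KRRow

variable {n : ℕ} [NeZero n] {l l' : ℕ}

/-- The number of letters `r` in the row `b`. -/
def count (b : KRRow n l) (r : ZMod n) : ℕ := b.1 r

theorem sum_replaceLetter {y : ZMod n → ℕ} (hy : ∑ r, y r = l) {a : ZMod n} (c : ZMod n)
    (ha : 0 < y a) :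
    ∑ r, (y - Pi.single a 1 + Pi.single c 1 : ZMod n → ℕ) r = l := by
  have h : y = (y - Pi.single a 1) + Pi.single a 1 := by
    funext r
    by_cases hr : r = a
    · subst hr
      simp only [Pi.add_apply, Pi.sub_apply, Pi.single_eq_same]
      omega
    · simp [Pi.single_eq_of_ne hr]
  rw [← hy]
  conv_rhs => rw [h]
  simp [Finset.sum_add_distrib]

/-- Replace one letter `a` of the row by a letter `c`; `none` (the zero of crystal theory) if there
is no letter `a`. -/
def replaceLetter (a c : ZMod n) (b : KRRow n l) : Option (KRRow n l) :=
  if h : 0 < b.1 a then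
    some ⟨b.1 - Pi.single a 1 + Pi.single c 1, sum_replaceLetter b.2 c h⟩
  else none

/-- The raising operator `e_i`, `i ∈ ZMod n`: replaces a letter `i + 1` by `i`. -/
def e (i : ZMod n) (b : KRRow n l) : Option (KRRow n l) := replaceLetter (i + 1) i b

/-- The lowering operator `f_i`, `i ∈ ZMod n`: replaces a letter `i` by `i + 1`. -/
def f (i : ZMod n) (b : KRRow n l) : Option (KRRow n l) := replaceLetter i (i + 1) b

/-- `ε_i(b)`, the number of times `e_i` can be applied to the row `b`. -/
def eps (i : ZMod n) (b : KRRow n l) : ℕ := b.count (i + 1)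

/-- `φ_i(b)`, the number of times `f_i` can be applied to the row `b`. -/
def phi (i : ZMod n) (b : KRRow n l) : ℕ := b.count i

/-- The highest weight row `1 1 ⋯ 1`. -/
def top (n : ℕ) [NeZero n] (l : ℕ) : KRRow n l :=
  ⟨Pi.single 1 l, by simp⟩

end KRRow

/-- The underlying set of the tensor product of two row crystals; `(b, b')` stands for `b ⊗ b'`. -/
abbrev KRTensor (n : ℕ) [NeZero n] (l l' : ℕ) : Type := KRRow n l × KRRow n l'

namespace KRTensor

variable {n : ℕ} [NeZero n] {l l' : ℕ}

/-- The tensor product rule is the signature rule on the word `b b'`, in which a letter `i + 1` is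
bracketed with a letter `i` to its right. By this rule `e_i` acts on the left factor of `b ⊗ b'`
exactly if `φ_i(b') < ε_i(b)`. -/
def ActsLeft (i : ZMod n) (p : KRTensor n l l') : Prop := p.2.phi i < p.1.eps i

instance (i : ZMod n) (p : KRTensor n l l') : Decidable (ActsLeft i p) :=
  inferInstanceAs (Decidable (_ < _))

/-- The raising operators of `B ⊗ B'`. -/
def e (i : ZMod n) (p : KRTensor n l l') : Option (KRTensor n l l') :=
  if ActsLeft i p then (p.1.e i).map (fun b => (b, p.2))
  else (p.2.e i).map (fun b' => (p.1, b'))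

/-- The lowering operators of `B ⊗ B'`. -/
def f (i : ZMod n) (p : KRTensor n l l') : Option (KRTensor n l l') :=
  if p.1.eps i < p.2.phi i then (p.2.f i).map (fun b' => (p.1, b'))
  else (p.1.f i).map (fun b => (b, p.2))

/-- `ε_i` on `B ⊗ B'` (the subtraction is truncated at `0`). -/
def eps (i : ZMod n) (p : KRTensor n l l') : ℕ := p.2.eps i + (p.1.eps i - p.2.phi i)

/-- `φ_i` on `B ⊗ B'` (the subtraction is truncated at `0`). -/
def phi (i : ZMod n) (p : KRTensor n l l') : ℕ := p.1.phi i + (p.2.phi i - p.1.eps i)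

/-- Isomorphisms of affine crystals `B ⊗ B' → B' ⊗ B`. The classical weight of an element is
`∑ i, (φ_i - ε_i) Λ_i`, so it is preserved as well. -/
structure IsCrystalIso (R : KRTensor n l l' ≃ KRTensor n l' l) : Prop where
  map_e : ∀ i p, e i (R p) = (e i p).map R
  map_f : ∀ i p, f i (R p) = (f i p).map R
  map_eps : ∀ i p, eps i (R p) = eps i p
  map_phi : ∀ i p, phi i (R p) = phi i p

end KRTensor

open Classical in
/-- The combinatorial `R`-matrix: the (unique) isomorphism of affine crystals
`B ⊗ B' → B' ⊗ B`. -/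
noncomputable def combR (n : ℕ) [NeZero n] (l l' : ℕ) : KRTensor n l l' ≃ KRTensor n l' l :=
  if h : ∃ R : KRTensor n l l' ≃ KRTensor n l' l, KRTensor.IsCrystalIso R then h.choose
  else Equiv.prodComm _ _

/-! ### Energy -/

/-- The defining properties of the local coenergy function of `B ⊗ B'`: it is constant on the
components obtained by forgetting the arrows of colour `0`, it increases (decreases) by one along
`e_0` if `e_0` acts on the left (right) factor both in `b ⊗ b'` and in its image under the
`R`-matrix, it does not change along `e_0` otherwise, and it vanishes at the tensor product of the
two rows consisting of letters `1` only. -/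
structure IsLocalCoenergy {n : ℕ} [NeZero n] {l l' : ℕ} (H : KRTensor n l l' → ℤ) : Prop where
  top : H (KRRow.top n l, KRRow.top n l') = 0
  classical : ∀ i, i ≠ 0 → ∀ p q, KRTensor.e i p = some q → H q = H p
  left_left : ∀ p q, KRTensor.e 0 p = some q →
    KRTensor.ActsLeft 0 p → KRTensor.ActsLeft 0 (combR n l l' p) → H q = H p + 1
  right_right : ∀ p q, KRTensor.e 0 p = some q →
    ¬ KRTensor.ActsLeft 0 p → ¬ KRTensor.ActsLeft 0 (combR n l l' p) → H q = H p - 1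
  mixed : ∀ p q, KRTensor.e 0 p = some q →
    ¬ (KRTensor.ActsLeft 0 p ↔ KRTensor.ActsLeft 0 (combR n l l' p)) → H q = H p

open Classical in
/-- The (unique) local coenergy function `H_{B,B'} : B ⊗ B' → ℤ`. -/
noncomputable def localCoenergy (n : ℕ) [NeZero n] (l l' : ℕ) : KRTensor n l l' → ℤ :=
  if h : ∃ H : KRTensor n l l' → ℤ, IsLocalCoenergy H then h.choose else fun _ => 0

/-- `moveRight b i k` is the factor in position `i + k` of the tensor that one gets from
`b = b_0 ⊗ ⋯ ⊗ b_{m-1}` by applying the `R`-matrix to the positions `(i, i+1)`, then to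
`(i+1, i+2)`, …, finally to `(i+k-1, i+k)`. It lies in `B_i`. -/
noncomputable def moveRight {n : ℕ} [NeZero n] {m : ℕ} {l : Fin m → ℕ}
    (b : ∀ i, KRRow n (l i)) (i : Fin m) : (k : ℕ) → (i : ℕ) + k < m → KRRow n (l i)
  | 0, _ => b i
  | k + 1, h =>
    (combR n (l i) (l ⟨i + (k + 1), h⟩)
      (moveRight b i k (by omega), b ⟨i + (k + 1), h⟩)).2

/-- The intrinsic energy `D_B(b)` of `b = b_0 ⊗ ⋯ ⊗ b_{m-1}`: the sum over `i < j` of the local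
coenergies of `b'_i ⊗ b_j`, with `b'_i ∈ B_i` the factor in position `j - 1` after `b_i` has been
moved there by `R`-matrices. -/
noncomputable def intrinsicEnergy {n : ℕ} [NeZero n] {m : ℕ} {l : Fin m → ℕ}
    (b : ∀ i, KRRow n (l i)) : ℤ :=
  ∑ i : Fin m, ∑ j : Fin m,
    if h : i < j then
      localCoenergy n (l i) (l j) (moveRight b i ((j : ℕ) - 1 - i) (by omega), b j)
    else 0

/-! ### Loop Schur functions and tropicalization -/

/-- Semistandard Young tableaux of shape `μ` with entries in `{0, …, m - 1}`. -/
abbrev BoundedSSYT (μ : YoungDiagram) (m : ℕ) : Type :=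
  {T : SemistandardYoungTableau μ // ∀ c ∈ μ.cells, T c.1 c.2 < m}

instance (μ : YoungDiagram) (m : ℕ) : Finite (BoundedSSYT μ m) := by
  refine Finite.of_injective
    (fun T : BoundedSSYT μ m => fun c : μ.cells => (⟨T.1 c.1.1 c.1.2, T.2 c.1 c.2⟩ : Fin m)) ?_
  intro T T' h
  apply Subtype.ext
  apply SemistandardYoungTableau.ext
  intro i j
  by_cases hc : (i, j) ∈ μ
  · have := congrFun h ⟨(i, j), by simpa using hc⟩
    simpa using congrArg Fin.val this
  · rw [T.1.zeros hc, T'.1.zeros hc]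

noncomputable instance (μ : YoungDiagram) (m : ℕ) : Fintype (BoundedSSYT μ m) :=
  Fintype.ofFinite _

/-- The loop Schur function `s_μ^{(r)}` in the variables `x_i^{(s)}`, `i : Fin m`, `s : ZMod n`.
The square in row `i` and column `j` has content `i - j`. -/
noncomputable def loopSchur (n m : ℕ) (r : ZMod n) (μ : YoungDiagram) :
    MvPolynomial (Fin m × ZMod n) ℕ :=
  ∑ T : BoundedSSYT μ m, ∏ c : μ.cells,
    MvPolynomial.X
      ((⟨T.1 c.1.1 c.1.2, T.2 c.1 c.2⟩ : Fin m), ((c.1.1 : ZMod n) - (c.1.2 : ZMod n)) + r)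

/-- The stretched staircase `k δ_t`, with row lengths `k t, k (t - 1), …, k`. -/
def stretchedStaircase (k t : ℕ) : YoungDiagram :=
  YoungDiagram.ofRowLens ((List.range t).map fun i => k * (t - i)) (by
    rw [List.sortedGE_iff_pairwise, List.pairwise_map]
    exact List.pairwise_lt_range.imp fun {a b} hab => Nat.mul_le_mul_left k (by omega))

/-- The tropicalization of a subtraction-free polynomial (one with coefficients in `ℕ`) as a
function on integer points: multiplication becomes addition and addition becomes minimum. -/
noncomputable def tropicalization {σ : Type*} (p : MvPolynomial σ ℕ) (x : σ → ℤ) : WithTop ℤ :=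
  Tropical.untrop (MvPolynomial.eval₂ (Nat.castRingHom (Tropical (WithTop ℤ)))
    (fun v => Tropical.trop ((x v : ℤ) : WithTop ℤ)) p)

open Finset

/-! Both sides are exponents of one positive quantity. The letter counts are lifted to elements of
size ε ^ count (`rowLift`), with ε a positive infinitesimal of an ordered field. Positive elements
cannot cancel, so orders of magnitude turn sums into minima and products into sums. It therefore
suffices to prove one identity between subtraction-free expressions and to read off the order of
each side.

Crystal side: the sliding numbers `RowSlide.slide` define a piecewise linear swap of two rows that
commutes with every `e i`. Since the tensor product is connected, this swap is the combinatorial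
`R`-matrix and the slide at letter 1 is the coenergy (`combR_eq_rowSwap`, `localCoenergy_eq_slide`).
Replacing minima by sums gives the birational `R`-matrix, and the intrinsic energy is the order of a
product of `geomSlide`s (`hasOrder_prod_geomSlide`).

Tableau side: stripping off the largest entry repeatedly writes the loop Schur function as a sum
over Gelfand-Tsetlin patterns (`sum_tableauWeight_eq_gtSum`).

The two meet in `gtSum_eq_prod_geomSlide`, where one determinant is computed twice. To a row a
belongs the operator u ↦ (k ↦ u k - a k * u (k + 1)). If u is in its kernel, multiplying a shift of
u by `geomSlide a b` gives a kernel sequence of the row a moved past b, and the operator of b sends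
that sequence back to (∏ a - ∏ b) u. Take the determinant whose columns are the kernel sequences of
the rows, each moved to the far right, and whose rows are evaluation points. Eliminating the last
column again and again yields `gtSum` times the product of all differences p j - p t, with p j the
product of the entries of row j. At evaluation points spaced by n, the rule u (k - n) = p u k makes
the same determinant a Vandermonde determinant times the product of the `geomSlide`s and the same
normalization. The differences cancel. -/

/-- A product over `n` cyclically consecutive residues is the product over all residues. -/
theorem prod_range_zmod {n : ℕ} [NeZero n] {M : Type*} [CommMonoid M] (g : ZMod n → M)
    (k : ZMod n) : ∏ t ∈ range n, g (k + (t : ZMod n)) = ∏ r, g r := by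
  refine Finset.prod_nbij (fun t : ℕ => k + (t : ZMod n)) (by simp) ?_ ?_ (by simp)
  · intro s hs t ht h
    have h' : (s : ZMod n) = t := add_left_cancel h
    have := congrArg ZMod.val h'
    rwa [ZMod.val_natCast_of_lt (by simpa using hs), ZMod.val_natCast_of_lt (by simpa using ht)]
      at this
  · intro r _
    exact ⟨(r - k).val, by simpa using ZMod.val_lt _, by simp⟩

theorem sum_range_zmod {n : ℕ} [NeZero n] {M : Type*} [AddCommMonoid M] (g : ZMod n → M)
    (k : ZMod n) : ∑ t ∈ range n, g (k + (t : ZMod n)) = ∑ r, g r :=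
  prod_range_zmod (M := Multiplicative M) g k

theorem one_ne_zero_zmod {n : ℕ} (hn : 1 < n) : (1 : ZMod n) ≠ 0 :=
  haveI : Fact (1 < n) := ⟨hn⟩
  one_ne_zero

theorem natCast_ne_zero_zmod {n s : ℕ} (h1 : 1 ≤ s) (hs : s < n) : (s : ZMod n) ≠ 0 := by
  intro h
  have := (ZMod.natCast_eq_zero_iff s n).1 h
  exact absurd (Nat.le_of_dvd h1 this) (by omega)

/-! ### Sliding one row over another -/

namespace RowSlide

variable {n : ℕ} [NeZero n] (y z : ZMod n → ℕ)

/-- The letters `k, …, k + s - 1` of `z` and the letters `k + s + 1, …, k + n - 1` of `y`. -/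
def term (k : ZMod n) (s : ℕ) : ℕ :=
  ∑ t ∈ range s, z (k + t) + ∑ t ∈ Ico s (n - 1), y (k + 1 + t)

/-- The number of cells by which the row `z` can be slid over `y`, for the cyclic order of the
letters that starts at `k`. -/
def slide (k : ZMod n) : ℕ :=
  (range n).inf' ⟨0, by simpa using NeZero.pos n⟩ (term y z k)

/-- The letters `k, …, k + s - 1` of `z` and the letters `k + s + 1, …, k + n` of `y`. -/
def fullTerm (k : ZMod n) (s : ℕ) : ℕ :=
  ∑ t ∈ range s, z (k + t) + ∑ t ∈ Ico s n, y (k + 1 + t)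

/-- The minimum of the mixed sums `fullTerm y z k s`, `0 < s < n`. -/
def mixed (hn : 1 < n) (k : ZMod n) : ℕ :=
  (Ico 1 n).inf' ⟨1, by simpa using hn⟩ (fullTerm y z k)

variable {y z}

theorem slide_le {k : ZMod n} {s : ℕ} (hs : s < n) : slide y z k ≤ term y z k s :=
  Finset.inf'_le _ (by simpa using hs)

theorem exists_slide_eq (y z : ZMod n → ℕ) (k : ZMod n) :
    ∃ s < n, slide y z k = term y z k s := by
  obtain ⟨s, hs, h⟩ := Finset.exists_mem_eq_inf' (s := range n)
    ⟨0, by simpa using NeZero.pos n⟩ (term y z k)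
  exact ⟨s, by simpa using hs, h⟩

theorem mixed_le {hn : 1 < n} {k : ZMod n} {s : ℕ} (h1 : 1 ≤ s) (hs : s < n) :
    mixed y z hn k ≤ fullTerm y z k s :=
  Finset.inf'_le _ (by simp [h1, hs])

theorem exists_mixed_eq (y z : ZMod n → ℕ) (hn : 1 < n) (k : ZMod n) :
    ∃ s, 1 ≤ s ∧ s < n ∧ mixed y z hn k = fullTerm y z k s := by
  obtain ⟨s, hs, h⟩ := Finset.exists_mem_eq_inf' (s := Ico 1 n)
    ⟨1, by simpa using hn⟩ (fullTerm y z k)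
  rw [mem_Ico] at hs
  exact ⟨s, hs.1, hs.2, h⟩

/-- The sum `term` at `k` lacks only the closing letter k + n = k of `y`; the sum at `k + 1` lacks
only the opening letter k of `z` (`right_add_term`). Completed, both become instances of `fullTerm`
at the same base `k`, so neighbouring slides can be compared. -/
theorem left_add_term (k : ZMod n) {s : ℕ} (hs : s < n) :
    y k + term y z k s = fullTerm y z k s := by
  have hk : k + 1 + ((n - 1 : ℕ) : ZMod n) = k := by
    rw [Nat.cast_sub (NeZero.pos n)]; simp
  have : ∑ t ∈ Ico s n, y (k + 1 + t) = ∑ t ∈ Ico s (n - 1), y (k + 1 + t) + y k := by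
    obtain ⟨m, rfl⟩ : ∃ m, n = m + 1 := ⟨n - 1, by omega⟩
    rw [Finset.sum_Ico_succ_top (by omega)]
    simp only [Nat.add_sub_cancel] at hk ⊢
    rw [hk]
  rw [fullTerm, this, term]
  ring

theorem right_add_term (k : ZMod n) {s : ℕ} (hs : s < n) :
    z k + term y z (k + 1) s = fullTerm y z k (s + 1) := by
  have h1 : ∑ t ∈ range (s + 1), z (k + t) = ∑ t ∈ range s, z (k + 1 + t) + z k := by
    rw [Finset.sum_range_succ']
    simp [add_assoc, add_comm (1 : ZMod n)]
  have h2 : ∑ t ∈ Ico (s + 1) n, y (k + 1 + t) = ∑ t ∈ Ico s (n - 1), y (k + 1 + 1 + t) := by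
    obtain ⟨m, rfl⟩ : ∃ m, n = m + 1 := ⟨n - 1, by omega⟩
    rw [← Finset.sum_Ico_add' (fun t : ℕ => y (k + 1 + t))]
    simp [add_assoc, add_comm (1 : ZMod (m + 1))]
  rw [fullTerm, h1, h2, term]
  ring

theorem fullTerm_zero (k : ZMod n) : fullTerm y z k 0 = ∑ r, y r := by
  simp [fullTerm, sum_range_zmod]

theorem fullTerm_self (k : ZMod n) : fullTerm y z k n = ∑ r, z r := by
  simp [fullTerm, sum_range_zmod]

/-- Together with `right_add_slide` this reduces all later statements about consecutive slides to
linear arithmetic: the two minima share the terms 0 < s < n and differ only in the extreme one, s =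
0 here and s = n there. -/
theorem left_add_slide (hn : 1 < n) (k : ZMod n) :
    y k + slide y z k = min (∑ r, y r) (mixed y z hn k) := by
  apply le_antisymm
  · refine le_min ?_ ?_
    · rw [← fullTerm_zero (z := z) k, ← left_add_term k (by omega)]
      exact Nat.add_le_add_left (slide_le (by omega)) _
    · obtain ⟨s, h1, hs, h⟩ := exists_mixed_eq y z hn k
      rw [h, ← left_add_term k hs]
      exact Nat.add_le_add_left (slide_le hs) _
  · obtain ⟨s, hs, h⟩ := exists_slide_eq y z k
    rw [h, left_add_term k hs]
    rcases Nat.eq_zero_or_pos s with rfl | h0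
    · rw [fullTerm_zero]; exact min_le_left _ _
    · exact (min_le_right _ _).trans (mixed_le h0 hs)

theorem right_add_slide (hn : 1 < n) (k : ZMod n) :
    z k + slide y z (k + 1) = min (∑ r, z r) (mixed y z hn k) := by
  apply le_antisymm
  · refine le_min ?_ ?_
    · have h := right_add_term (y := y) (z := z) k (s := n - 1) (by omega)
      rw [Nat.sub_add_cancel (by omega), fullTerm_self] at h
      rw [← h]
      exact Nat.add_le_add_left (slide_le (by omega)) _
    · obtain ⟨s, h1, hs, h⟩ := exists_mixed_eq y z hn k
      obtain ⟨s, rfl⟩ : ∃ s', s = s' + 1 := ⟨s - 1, by omega⟩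
      rw [h, ← right_add_term k (by omega)]
      exact Nat.add_le_add_left (slide_le (by omega)) _
  · obtain ⟨s, hs, h⟩ := exists_slide_eq y z (k + 1)
    rw [h, right_add_term k hs]
    rcases eq_or_ne (s + 1) n with h0 | h0
    · rw [h0, fullTerm_self]; exact min_le_left _ _
    · exact (min_le_right _ _).trans (mixed_le (by omega) (by omega))

theorem slide_le_sum_left (k : ZMod n) : slide y z k ≤ ∑ r, y r := by
  have h := left_add_term (y := y) (z := z) k (NeZero.pos n)
  rw [fullTerm_zero] at h
  exact (slide_le (NeZero.pos n)).trans (by omega)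

theorem slide_le_sum_right (k : ZMod n) : slide y z k ≤ ∑ r, z r := by
  have hpos := NeZero.pos n
  have h := right_add_term (y := y) (z := z) (k - 1) (s := n - 1) (by omega)
  rw [Nat.sub_add_cancel (by omega), fullTerm_self, sub_add_cancel] at h
  exact (slide_le (s := n - 1) (by omega)).trans (by omega)

/-- This and `slide_succ_le_left` ensure that the subtractions in `displaced` and `moved` are not
truncated. -/
theorem slide_le_right (hn : 1 < n) (k : ZMod n) : slide y z k ≤ z k + slide y z (k + 1) := by
  have h1 := left_add_slide (y := y) (z := z) hn k
  have h2 := right_add_slide (y := y) (z := z) hn k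
  have h3 := slide_le_sum_right (y := y) (z := z) k
  omega

theorem slide_succ_le_left (hn : 1 < n) (k : ZMod n) :
    slide y z (k + 1) ≤ y k + slide y z k := by
  have h1 := left_add_slide (y := y) (z := z) hn k
  have h2 := right_add_slide (y := y) (z := z) hn k
  have h3 := slide_le_sum_left (y := y) (z := z) (k + 1)
  omega

variable (y z) in
/-- The new right-hand row. -/
def moved (k : ZMod n) : ℕ := y k + slide y z k - slide y z (k + 1)

variable (y z) in
/-- The new left-hand row. -/
def displaced (k : ZMod n) : ℕ := z k + slide y z (k + 1) - slide y z k

theorem moved_add (hn : 1 < n) (k : ZMod n) :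
    moved y z k + slide y z (k + 1) = y k + slide y z k :=
  Nat.sub_add_cancel (slide_succ_le_left hn k)

theorem displaced_add (hn : 1 < n) (k : ZMod n) :
    displaced y z k + slide y z k = z k + slide y z (k + 1) :=
  Nat.sub_add_cancel (slide_le_right hn k)

theorem sum_moved (hn : 1 < n) : ∑ r, moved y z r = ∑ r, y r := by
  have h := Finset.sum_congr rfl fun r (_ : r ∈ univ) => moved_add (y := y) (z := z) hn r
  rw [Finset.sum_add_distrib, Finset.sum_add_distrib] at h
  have h' : ∑ r, slide y z (r + 1) = ∑ r, slide y z r :=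
    Equiv.sum_comp (Equiv.addRight (1 : ZMod n)) (slide y z)
  omega

theorem sum_displaced (hn : 1 < n) : ∑ r, displaced y z r = ∑ r, z r := by
  have h := Finset.sum_congr rfl fun r (_ : r ∈ univ) => displaced_add (y := y) (z := z) hn r
  rw [Finset.sum_add_distrib, Finset.sum_add_distrib] at h
  have h' : ∑ r, slide y z (r + 1) = ∑ r, slide y z r :=
    Equiv.sum_comp (Equiv.addRight (1 : ZMod n)) (slide y z)
  omega

/-- With Y, Z the row sums and M the mixed minima, each side is min(Y, Z, M k, M (k + 1)) minus the
slide at k + 1. This is what makes `eps` and `phi` invariant under the swap. -/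
theorem min_displaced_moved (hn : 1 < n) (k : ZMod n) :
    min (displaced y z (k + 1)) (moved y z k) = min (y (k + 1)) (z k) := by
  have h1 := left_add_slide (y := y) (z := z) hn k
  have h2 := right_add_slide (y := y) (z := z) hn k
  have h3 := left_add_slide (y := y) (z := z) hn (k + 1)
  have h4 := right_add_slide (y := y) (z := z) hn (k + 1)
  have h5 := moved_add (y := y) (z := z) hn k
  have h6 := displaced_add (y := y) (z := z) hn (k + 1)
  omega

/-! #### Replacing a letter `i + 1` by `i` -/

theorem term_succ (k : ZMod n) {s : ℕ} (hs : s + 1 < n) :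
    term y z k (s + 1) + y (k + s + 1) = term y z k s + z (k + s) := by
  rw [term, term, Finset.sum_range_succ, Finset.sum_eq_sum_Ico_succ_bot (show s < n - 1 by omega),
    add_right_comm k (s : ZMod n) 1]
  ring

/-- `y'` arises from `y` by replacing a letter `i + 1` by `i`. -/
def Raises (i : ZMod n) (y y' : ZMod n → ℕ) : Prop :=
  ∀ r, y' r + (if r = i + 1 then 1 else 0) = y r + (if r = i then 1 else 0)

/-- An arc of letters notices the replacement only if one of its ends separates i from i + 1. -/
theorem Raises.sum_range {i : ZMod n} {y y' : ZMod n → ℕ} (h : Raises i y y') (k : ZMod n)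
    (s : ℕ) :
    ∑ t ∈ range s, y' (k + t) + (if k = i + 1 then 1 else 0) =
      ∑ t ∈ range s, y (k + t) + (if k + s = i + 1 then 1 else 0) := by
  induction s with
  | zero => simp
  | succ s ih =>
    have := h (k + s)
    rw [Finset.sum_range_succ, Finset.sum_range_succ, Nat.cast_succ, ← add_assoc]
    simp only [add_left_inj] at *
    omega

theorem Raises.sum_Ico {i : ZMod n} {y y' : ZMod n → ℕ} (h : Raises i y y') (k : ZMod n)
    {s e : ℕ} (hs : s ≤ e) :
    ∑ t ∈ Ico s e, y' (k + t) + (if k + s = i + 1 then 1 else 0) =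
      ∑ t ∈ Ico s e, y (k + t) + (if k + e = i + 1 then 1 else 0) := by
  have h1 := h.sum_range k s
  have h2 := h.sum_range k e
  have h3 := Finset.sum_range_add_sum_Ico (fun t : ℕ => y (k + t)) hs
  have h4 := Finset.sum_range_add_sum_Ico (fun t : ℕ => y' (k + t)) hs
  omega

theorem Raises.sum_eq {i : ZMod n} {y y' : ZMod n → ℕ} (h : Raises i y y') :
    ∑ r, y' r = ∑ r, y r := by
  have := h.sum_range 0 n
  rw [sum_range_zmod, sum_range_zmod] at this
  simpa using this

theorem term_raise_left {i : ZMod n} {y' : ZMod n → ℕ} (h : Raises i y y') (k : ZMod n) {s : ℕ}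
    (hs : s < n) :
    term y' z k s + (if k + s = i then 1 else 0) =
      term y z k s + (if k = i + 1 then 1 else 0) := by
  have := h.sum_Ico (k + 1) (show s ≤ n - 1 by omega)
  have hk : k + 1 + ((n - 1 : ℕ) : ZMod n) = k := by
    rw [Nat.cast_sub (NeZero.pos n)]; simp
  rw [hk, add_right_comm k 1 (s : ZMod n)] at this
  simp only [add_left_inj] at this
  rw [term, term]
  omega

theorem term_raise_right {i : ZMod n} {z' : ZMod n → ℕ} (h : Raises i z z') (k : ZMod n) (s : ℕ) :
    term y z' k s + (if k = i + 1 then 1 else 0) =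
      term y z k s + (if k + s = i + 1 then 1 else 0) := by
  have := h.sum_range k s
  rw [term, term]
  omega

/-- Only the term with k + s = i changes, dropping by one. By `term_succ` and `hlt` the next term
was already strictly smaller, so the minimum does not move. The next term exists because s = n - 1
would mean k = i + 1. -/
theorem slide_raise_left {i : ZMod n} {y' : ZMod n → ℕ} (h : Raises i y y')
    (hlt : z i < y (i + 1)) {k : ZMod n} (hk : k ≠ i + 1) : slide y' z k = slide y z k := by
  apply le_antisymm
  · obtain ⟨s, hs, e⟩ := exists_slide_eq y z k
    have h1 := term_raise_left (z := z) h k hs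
    have h2 := slide_le (y := y') (z := z) (k := k) hs
    rw [if_neg hk] at h1
    omega
  · obtain ⟨s, hs, e⟩ := exists_slide_eq y' z k
    have h1 := term_raise_left (z := z) h k hs
    rw [if_neg hk] at h1
    by_cases hi : k + s = i
    · have hs' : s + 1 < n := by
        refine lt_of_le_of_ne hs fun h0 => hk ?_
        have : ((s + 1 : ℕ) : ZMod n) = 0 := by rw [h0]; simp
        rw [← hi, add_assoc]
        push_cast at this
        rw [this, add_zero]
      have h3 := term_succ (y := y) (z := z) k hs'
      have h4 := slide_le (y := y) (z := z) (k := k) hs'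
      rw [hi] at h3
      rw [if_pos hi] at h1
      omega
    · have h4 := slide_le (y := y) (z := z) (k := k) hs
      rw [if_neg hi] at h1
      omega

/-- Only the term with k + s = i + 1 changes, growing by one. The preceding term is unchanged and,
by `term_succ` and `hle`, was at most as large. -/
theorem slide_raise_right {i : ZMod n} {z' : ZMod n → ℕ} (h : Raises i z z')
    (hle : y (i + 1) ≤ z i) {k : ZMod n} (hk : k ≠ i + 1) : slide y z' k = slide y z k := by
  apply le_antisymm
  · obtain ⟨s, hs, e⟩ := exists_slide_eq y z k
    have h1 := term_raise_right (y := y) h k s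
    rw [if_neg hk] at h1
    by_cases hi : k + s = i + 1
    · obtain ⟨s, rfl⟩ : ∃ s', s = s' + 1 := by
        refine ⟨s - 1, (Nat.sub_add_cancel (Nat.pos_of_ne_zero fun h0 => hk ?_)).symm⟩
        simpa [h0] using hi
      rw [Nat.cast_succ, ← add_assoc, add_left_inj] at hi
      have h2 := term_raise_right (y := y) h k s
      have h3 := term_succ (y := y) (z := z) k hs
      have h4 := slide_le (y := y) (z := z') (k := k) (s := s) (by omega)
      have hne : (if k + s = i + 1 then 1 else 0 : ℕ) = 0 := by
        rw [if_neg]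
        rw [hi]
        intro h0
        exact one_ne_zero_zmod (show 1 < n by omega) (by simpa using h0)
      rw [if_neg hk, hne] at h2
      rw [hi] at h3
      omega
    · have h4 := slide_le (y := y) (z := z') (k := k) hs
      rw [if_neg hi] at h1
      omega
  · obtain ⟨s, hs, e⟩ := exists_slide_eq y z' k
    have h1 := term_raise_right (y := y) h k s
    have h2 := slide_le (y := y) (z := z) (k := k) hs
    rw [if_neg hk] at h1
    omega

/-- Every mixed sum based at `i` contains the letter i of `y` (as i + n) and omits its letter i + 1.
In `mixed_raise_right`, based at `i + 1`, every mixed sum contains the letter i + 1 of `z` and omits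
its letter i. -/
theorem mixed_raise_left (hn : 1 < n) {i : ZMod n} {y' : ZMod n → ℕ} (h : Raises i y y') :
    mixed y' z hn i = mixed y z hn i + 1 := by
  have key : ∀ s, 1 ≤ s → s < n → fullTerm y' z i s = fullTerm y z i s + 1 := by
    intro s h1 hs
    rw [← left_add_term i hs, ← left_add_term i hs]
    have h2 := term_raise_left (z := z) h i hs
    have h3 := h i
    have h4 : i + (s : ZMod n) ≠ i := by simpa using natCast_ne_zero_zmod h1 hs
    have h5 : i ≠ i + 1 := by simpa using one_ne_zero_zmod hn
    rw [if_neg h4, if_neg h5] at h2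
    rw [if_neg h5, if_pos rfl] at h3
    omega
  apply le_antisymm
  · obtain ⟨s, h1, hs, e⟩ := exists_mixed_eq y z hn i
    rw [e, ← key s h1 hs]
    exact mixed_le h1 hs
  · obtain ⟨s, h1, hs, e⟩ := exists_mixed_eq y' z hn i
    rw [e, key s h1 hs]
    exact Nat.add_le_add_right (mixed_le h1 hs) 1

theorem mixed_raise_right (hn : 1 < n) {i : ZMod n} {z' : ZMod n → ℕ} (h : Raises i z z') :
    mixed y z' hn (i + 1) + 1 = mixed y z hn (i + 1) := by
  have key : ∀ s, 1 ≤ s → s < n → fullTerm y z' (i + 1) s + 1 = fullTerm y z (i + 1) s := by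
    intro s h1 hs
    rw [← left_add_term _ hs, ← left_add_term _ hs]
    have h2 := term_raise_right (y := y) h (i + 1) s
    have h4 : i + 1 + (s : ZMod n) ≠ i + 1 := by simpa using natCast_ne_zero_zmod h1 hs
    rw [if_neg h4, if_pos rfl] at h2
    omega
  apply le_antisymm
  · obtain ⟨s, h1, hs, e⟩ := exists_mixed_eq y z hn (i + 1)
    rw [e, ← key s h1 hs]
    exact Nat.add_le_add_right (mixed_le h1 hs) 1
  · obtain ⟨s, h1, hs, e⟩ := exists_mixed_eq y z' hn (i + 1)
    rw [e, key s h1 hs]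
    exact mixed_le h1 hs

end RowSlide

/-! ### The combinatorial `R`-matrix and the local coenergy of two rows -/

namespace KRRow

open RowSlide

variable {n : ℕ} [NeZero n] {l : ℕ}

theorem ext_count {b b' : KRRow n l} (h : ∀ r, b.count r = b'.count r) : b = b' :=
  Subtype.ext (funext h)

theorem sum_count (b : KRRow n l) : ∑ r, b.count r = l := b.2

theorem mk_count (y : ZMod n → ℕ) (h : ∑ r, y r = l) : count (⟨y, h⟩ : KRRow n l) = y := rfl

theorem replaceLetter_eq_some_iff {a c : ZMod n} {b b' : KRRow n l} :
    replaceLetter a c b = some b' ↔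
      0 < b.count a ∧ ∀ r, b'.count r = b.count r - (if r = a then 1 else 0) +
        (if r = c then 1 else 0) := by
  unfold replaceLetter
  by_cases h : 0 < b.count a
  · rw [dif_pos (show 0 < b.1 a from h)]
    constructor
    · intro h'
      obtain rfl := Option.some.inj h'
      refine ⟨h, fun r => ?_⟩
      rw [← Pi.single_apply a (1 : ℕ) r, ← Pi.single_apply c (1 : ℕ) r]
      rfl
    · rintro ⟨_, h'⟩
      refine congrArg some (ext_count fun r => ?_)
      rw [h' r, ← Pi.single_apply a (1 : ℕ) r, ← Pi.single_apply c (1 : ℕ) r]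
      rfl
  · rw [dif_neg (show ¬ 0 < b.1 a from h)]
    simp [h]

theorem exists_replaceLetter {a c : ZMod n} {b : KRRow n l} (h : 0 < b.count a) :
    ∃ b', replaceLetter a c b = some b' := by
  unfold replaceLetter
  rw [dif_pos (show 0 < b.1 a from h)]
  exact ⟨_, rfl⟩

theorem e_eq_some_iff (hn : 1 < n) {i : ZMod n} {b b' : KRRow n l} :
    e i b = some b' ↔ Raises i b.count b'.count := by
  have h1 : i + 1 ≠ i := by simpa using one_ne_zero_zmod hn
  rw [e, replaceLetter_eq_some_iff]
  constructor
  · rintro ⟨h0, h⟩ r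
    rw [h r]
    by_cases hr : r = i + 1
    · subst hr; simp only [if_pos, if_neg h1]; omega
    · simp only [if_neg hr]; omega
  · intro h
    have h2 := h (i + 1)
    rw [if_pos rfl, if_neg h1] at h2
    refine ⟨by omega, fun r => ?_⟩
    have h3 := h r
    by_cases hr : r = i
    · subst hr; simp only [if_pos, if_neg h1.symm] at h3 ⊢; omega
    · simp only [if_neg hr] at h3 ⊢; omega

theorem f_eq_some_iff (hn : 1 < n) {i : ZMod n} {b b' : KRRow n l} :
    f i b = some b' ↔ Raises i b'.count b.count := by
  have h1 : i + 1 ≠ i := by simpa using one_ne_zero_zmod hn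
  rw [f, replaceLetter_eq_some_iff]
  constructor
  · rintro ⟨h0, h⟩ r
    rw [h r]
    by_cases hr : r = i
    · subst hr; simp only [if_pos, if_neg h1.symm]; omega
    · simp only [if_neg hr]; omega
  · intro h
    have h2 := h i
    rw [if_pos rfl, if_neg h1.symm] at h2
    refine ⟨by omega, fun r => ?_⟩
    have h3 := h r
    by_cases hr : r = i + 1
    · subst hr; simp only [if_pos, if_neg h1] at h3 ⊢; omega
    · simp only [if_neg hr] at h3 ⊢; omega

end KRRow

namespace KRTensor

open RowSlide

variable {n : ℕ} [NeZero n] {l l' : ℕ}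

theorem e_eq_some_iff (hn : 1 < n) {i : ZMod n} {p q : KRTensor n l l'} :
    e i p = some q ↔
      (p.2.count i < p.1.count (i + 1) ∧ Raises i p.1.count q.1.count ∧ q.2 = p.2) ∨
      (p.1.count (i + 1) ≤ p.2.count i ∧ Raises i p.2.count q.2.count ∧ q.1 = p.1) := by
  obtain ⟨y, z⟩ := p
  obtain ⟨y', z'⟩ := q
  unfold e
  by_cases h : ActsLeft i (y, z)
  · have h' : z.count i < y.count (i + 1) := h
    simp only [if_pos h, Option.map_eq_some_iff, Prod.mk.injEq, KRRow.e_eq_some_iff hn]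
    constructor
    · rintro ⟨b, hb, rfl, rfl⟩
      exact Or.inl ⟨h', hb, rfl⟩
    · rintro (⟨_, hb, rfl⟩ | ⟨h0, _⟩)
      · exact ⟨y', hb, rfl, rfl⟩
      · omega
  · have h' : y.count (i + 1) ≤ z.count i := not_lt.1 h
    simp only [if_neg h, Option.map_eq_some_iff, Prod.mk.injEq, KRRow.e_eq_some_iff hn]
    constructor
    · rintro ⟨b, hb, rfl, rfl⟩
      exact Or.inr ⟨h', hb, rfl⟩
    · rintro (⟨h0, _⟩ | ⟨_, hb, rfl⟩)
      · omega
      · exact ⟨z', hb, rfl, rfl⟩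

theorem f_eq_some_iff (hn : 1 < n) {i : ZMod n} {p q : KRTensor n l l'} :
    f i q = some p ↔ e i p = some q := by
  rw [e_eq_some_iff hn]
  have h1 : i + 1 ≠ i := by simpa using one_ne_zero_zmod hn
  obtain ⟨y, z⟩ := p
  obtain ⟨y', z'⟩ := q
  unfold f
  by_cases h : y'.count (i + 1) < z'.count i
  · rw [if_pos (show KRRow.eps i y' < KRRow.phi i z' from h)]
    simp only [Option.map_eq_some_iff, Prod.mk.injEq,
      KRRow.f_eq_some_iff hn]
    constructor
    · rintro ⟨b, hb, rfl, rfl⟩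
      have := hb i
      rw [if_neg h1.symm, if_pos rfl] at this
      exact Or.inr ⟨by omega, hb, rfl⟩
    · rintro (⟨h0, hb, rfl⟩ | ⟨_, hb, rfl⟩)
      · have := hb (i + 1)
        rw [if_neg h1, if_pos rfl] at this
        omega
      · exact ⟨z, hb, rfl, rfl⟩
  · rw [if_neg (show ¬ KRRow.eps i y' < KRRow.phi i z' from h)]
    simp only [Option.map_eq_some_iff, Prod.mk.injEq,
      KRRow.f_eq_some_iff hn]
    constructor
    · rintro ⟨b, hb, rfl, rfl⟩
      have := hb (i + 1)
      rw [if_neg h1, if_pos rfl] at this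
      exact Or.inl ⟨by omega, hb, rfl⟩
    · rintro (⟨_, hb, rfl⟩ | ⟨h0, hb, rfl⟩)
      · exact ⟨y, hb, rfl, rfl⟩
      · have := hb i
        rw [if_neg h1.symm, if_pos rfl] at this
        omega

theorem exists_e_of_left {i : ZMod n} {p : KRTensor n l l'} (h : p.2.count i < p.1.count (i + 1)) :
    ∃ q, e i p = some q := by
  unfold e
  rw [if_pos (show ActsLeft i p from h)]
  obtain ⟨b, hb⟩ := KRRow.exists_replaceLetter (c := i) (Nat.zero_lt_of_lt h)
  exact ⟨(b, p.2), by rw [KRRow.e, hb]; rfl⟩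

theorem exists_e_of_right {i : ZMod n} {p : KRTensor n l l'} (h : 0 < p.2.count (i + 1)) :
    ∃ q, e i p = some q := by
  by_cases h0 : p.2.count i < p.1.count (i + 1)
  · exact exists_e_of_left h0
  unfold e
  rw [if_neg (show ¬ ActsLeft i p from h0)]
  obtain ⟨b, hb⟩ := KRRow.exists_replaceLetter (c := i) h
  exact ⟨(p.1, b), by rw [KRRow.e, hb]; rfl⟩

theorem e_eq_none_iff (hn : 1 < n) {i : ZMod n} {p : KRTensor n l l'} :
    e i p = none ↔ eps i p = 0 := by
  simp only [eps, KRRow.eps, KRRow.phi]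
  constructor
  · intro h
    by_contra hne
    have : ∃ q, e i p = some q := by
      by_cases h0 : p.2.count i < p.1.count (i + 1)
      · exact exists_e_of_left h0
      · exact exists_e_of_right (by omega)
    obtain ⟨q, hq⟩ := this
    rw [h] at hq
    cases hq
  · intro h
    cases hq : e i p with
    | none => rfl
    | some q =>
      have h1 : i + 1 ≠ i := by simpa using one_ne_zero_zmod hn
      rcases (e_eq_some_iff hn).1 hq with ⟨h0, _⟩ | ⟨_, hb, _⟩
      · omega
      · have := hb (i + 1)
        rw [if_neg h1, if_pos rfl] at this
        omega

/-! #### Connectedness -/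

theorem sum_mul_raises {i : ZMod n} {y y' : ZMod n → ℕ} (h : Raises i y y') (w : ZMod n → ℕ) :
    ∑ r, y' r * w r + w (i + 1) = ∑ r, y r * w r + w i := by
  have := Finset.sum_congr rfl fun r (_ : r ∈ univ) => congrArg (· * w r) (h r)
  simpa [add_mul, Finset.sum_add_distrib] using this

theorem val_succ_of_ne {i : ZMod n} (hi : i + 1 ≠ 0) : (i + 1).val = i.val + 1 := by
  have hlt := ZMod.val_lt i
  rcases Nat.lt_or_ge (i.val + 1) n with h | h
  · conv_lhs => rw [← ZMod.natCast_zmod_val i, ← Nat.cast_succ]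
    exact ZMod.val_natCast_of_lt h
  · exfalso
    apply hi
    have h' : i.val + 1 = n := by omega
    rw [← ZMod.natCast_zmod_val i, ← Nat.cast_succ, Nat.succ_eq_add_one, h', ZMod.natCast_self]

theorem eq_top_of_forall (b : KRRow n l) (h : ∀ r, r ≠ 1 → b.count r = 0) : b = KRRow.top n l := by
  have hs : b.count 1 = l := by
    have := b.sum_count
    rwa [Finset.sum_eq_single 1 (fun r _ hr => h r hr) (by simp)] at this
  refine KRRow.ext_count fun r => ?_
  rw [KRRow.top, KRRow.mk_count]
  by_cases hr : r = 1
  · subst hr; simp [hs]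
  · simp [hr, h r hr]

theorem top_apply_of_ne {r : ZMod n} (hr : r ≠ 1) : (KRRow.top n l).count r = 0 := by
  rw [KRRow.top, KRRow.mk_count]
  simp [hr]

/-- The affine crystal `B ⊗ B'` is connected. -/
theorem connected (hn : 1 < n) {P : KRTensor n l l' → Prop}
    (htop : P (KRRow.top n l, KRRow.top n l'))
    (he : ∀ i p q, e i p = some q → (P p ↔ P q)) (p : KRTensor n l l') : P p := by
  -- Against a right row of letters 1 only, every letter r ≠ 1 of the left row can be pushed up
  -- cyclically to r + 1: the right row has no r, so the reverse arrow acts on the left. The measure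
  -- is the total distance still to go to reach 1.
  have right_top : ∀ N : ℕ, ∀ y : KRRow n l, ∑ r, y.count r * (1 - r).val = N →
      P (y, KRRow.top n l') := by
    intro N
    induction N using Nat.strong_induction_on with
    | _ N ih =>
      intro y hy
      by_cases hall : ∀ r, r ≠ 1 → y.count r = 0
      · rw [eq_top_of_forall y hall]; exact htop
      · push Not at hall
        obtain ⟨r, hr, h0⟩ := hall
        obtain ⟨y', hy'⟩ : ∃ y', KRRow.f r y = some y' :=
          KRRow.exists_replaceLetter (Nat.pos_of_ne_zero h0)
        rw [KRRow.f_eq_some_iff hn] at hy'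
        have h1 := sum_mul_raises hy' fun r => (1 - r).val
        have h2 : (1 - r : ZMod n).val = (1 - (r + 1)).val + 1 := by
          rw [← val_succ_of_ne]
          · congr 1; ring
          · intro h; exact hr (by linear_combination -h)
        refine (he r (y', KRRow.top n l') (y, KRRow.top n l') ?_).1
          (ih _ (by omega) y' rfl)
        rw [e_eq_some_iff hn]
        refine Or.inl ⟨?_, hy', rfl⟩
        have := hy' (r + 1)
        rw [if_pos rfl] at this
        simp only [top_apply_of_ne hr]
        have h3 : r + 1 ≠ r := by simpa using one_ne_zero_zmod hn
        rw [if_neg h3] at this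
        omega
  -- Raising with the colour below a letter ≠ 1 of the right row decreases the total distance above
  -- 1, whichever factor is hit.
  have main : ∀ N : ℕ, ∀ p : KRTensor n l l',
      ∑ r, p.1.count r * (r - 1).val + ∑ r, p.2.count r * (r - 1).val = N → P p := by
    intro N
    induction N using Nat.strong_induction_on with
    | _ N ih =>
      intro p hp
      by_cases hall : ∀ r, r ≠ 1 → p.2.count r = 0
      · have := right_top _ p.1 rfl
        rwa [← eq_top_of_forall p.2 hall] at this
      · push Not at hall
        obtain ⟨r, hr, h0⟩ := hall
        obtain ⟨i, rfl⟩ : ∃ i, r = i + 1 := ⟨r - 1, by ring⟩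
        obtain ⟨q, hq⟩ := exists_e_of_right (Nat.pos_of_ne_zero h0)
        have h2 : (i + 1 - 1).val = (i - 1).val + 1 := by
          rw [← val_succ_of_ne]
          · congr 1; ring
          · intro h; exact hr (by linear_combination h)
        refine (he i p q hq).2 (ih _ ?_ q rfl)
        rcases (e_eq_some_iff hn).1 hq with ⟨_, hb, e2⟩ | ⟨_, hb, e1⟩
        · have h1 := sum_mul_raises hb fun r => (r - 1).val
          rw [e2]
          omega
        · have h1 := sum_mul_raises hb fun r => (r - 1).val
          rw [e1]
          omega
  exact main _ p rfl

/-! #### The explicit isomorphism -/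

/-- The piecewise linear `R`-matrix. -/
def rowSwap (hn : 1 < n) (p : KRTensor n l l') : KRTensor n l' l :=
  (⟨displaced p.1.count p.2.count, (sum_displaced hn).trans p.2.2⟩,
    ⟨moved p.1.count p.2.count, (sum_moved hn).trans p.1.2⟩)

/-- The number of cells by which the right row can be slid over the left one. -/
def slide (p : KRTensor n l l') (k : ZMod n) : ℕ := RowSlide.slide p.1.count p.2.count k

theorem slide_of_e (hn : 1 < n) {i : ZMod n} {p q : KRTensor n l l'} (h : e i p = some q)
    {k : ZMod n} (hk : k ≠ i + 1) : slide q k = slide p k := by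
  rcases (e_eq_some_iff hn).1 h with ⟨h0, hb, e2⟩ | ⟨h0, hb, e1⟩
  · unfold slide; rw [e2]; exact slide_raise_left hb h0 hk
  · unfold slide; rw [e1]; exact slide_raise_right hb h0 hk

/-- With Y, Z, M as in `min_displaced_moved`, `h1` says min(Z, M i) < min(Y, M (i + 1)) and `h2`
says min(Y, M i) < min(Z, M (i + 1)). Together they force M i < Z. Since M i grows by one, so does
min(Z, M i), and with it the slide. In `slide_left_right` the negated second inequality forces Z ≤ M
i instead. -/
theorem slide_left_left (hn : 1 < n) {i : ZMod n} {p q : KRTensor n l l'} (h : e i p = some q)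
    (h1 : ActsLeft i p) (h2 : ActsLeft i (rowSwap hn p)) :
    slide q (i + 1) = slide p (i + 1) + 1 := by
  have hl : p.2.count i < p.1.count (i + 1) := h1
  have hl' : moved p.1.count p.2.count i < displaced p.1.count p.2.count (i + 1) := h2
  rcases (e_eq_some_iff hn).1 h with ⟨h0, hb, e2⟩ | ⟨h0, hb, e1⟩
  · unfold slide
    rw [e2]
    have a1 := mixed_raise_left (z := p.2.count) hn hb
    have a2 := right_add_slide (y := q.1.count) (z := p.2.count) hn i
    have a3 := right_add_slide (y := p.1.count) (z := p.2.count) hn i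
    have a4 := left_add_slide (y := p.1.count) (z := p.2.count) hn i
    have a5 := left_add_slide (y := p.1.count) (z := p.2.count) hn (i + 1)
    have a6 := right_add_slide (y := p.1.count) (z := p.2.count) hn (i + 1)
    have a7 := moved_add (y := p.1.count) (z := p.2.count) hn i
    have a8 := displaced_add (y := p.1.count) (z := p.2.count) hn (i + 1)
    omega
  · omega

theorem slide_left_right (hn : 1 < n) {i : ZMod n} {p q : KRTensor n l l'} (h : e i p = some q)
    (h1 : ActsLeft i p) (h2 : ¬ ActsLeft i (rowSwap hn p)) :
    slide q (i + 1) = slide p (i + 1) := by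
  have hl : p.2.count i < p.1.count (i + 1) := h1
  have hl' : ¬ moved p.1.count p.2.count i < displaced p.1.count p.2.count (i + 1) := h2
  rcases (e_eq_some_iff hn).1 h with ⟨h0, hb, e2⟩ | ⟨h0, hb, e1⟩
  · unfold slide
    rw [e2]
    have a1 := mixed_raise_left (z := p.2.count) hn hb
    have a2 := right_add_slide (y := q.1.count) (z := p.2.count) hn i
    have a3 := right_add_slide (y := p.1.count) (z := p.2.count) hn i
    have a4 := left_add_slide (y := p.1.count) (z := p.2.count) hn i
    have a5 := left_add_slide (y := p.1.count) (z := p.2.count) hn (i + 1)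
    have a6 := right_add_slide (y := p.1.count) (z := p.2.count) hn (i + 1)
    have a7 := moved_add (y := p.1.count) (z := p.2.count) hn i
    have a8 := displaced_add (y := p.1.count) (z := p.2.count) hn (i + 1)
    omega
  · omega

theorem slide_right_cases (hn : 1 < n) {i : ZMod n} {p q : KRTensor n l l'} (h : e i p = some q)
    (h1 : ¬ ActsLeft i p) :
    (¬ ActsLeft i (rowSwap hn p) → slide q (i + 1) + 1 = slide p (i + 1)) ∧
      (ActsLeft i (rowSwap hn p) → slide q (i + 1) = slide p (i + 1)) := by
  have hl : ¬ p.2.count i < p.1.count (i + 1) := h1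
  have hl' : ActsLeft i (rowSwap hn p) ↔
    moved p.1.count p.2.count i < displaced p.1.count p.2.count (i + 1) := Iff.rfl
  rcases (e_eq_some_iff hn).1 h with ⟨h0, hb, e2⟩ | ⟨h0, hb, e1⟩
  · omega
  · have h2 : i + 1 ≠ i := by simpa using one_ne_zero_zmod hn
    have hne : i + 1 + 1 ≠ i + 1 := by simpa using one_ne_zero_zmod hn
    unfold slide
    rw [hl', e1]
    -- The slide at i + 2 is unchanged while the right row loses a letter i + 1. Comparing
    -- `right_add_slide` at i + 1 before and after shows that the mixed minimum there is at most the
    -- right row sum, which settles the ties.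
    have a0 := slide_raise_right (y := p.1.count) hb h0 hne
    have a1 := mixed_raise_right (y := p.1.count) hn hb
    have a2 := right_add_slide (y := p.1.count) (z := q.2.count) hn (i + 1)
    have a2' := left_add_slide (y := p.1.count) (z := q.2.count) hn (i + 1)
    have a3 := right_add_slide (y := p.1.count) (z := p.2.count) hn i
    have a4 := left_add_slide (y := p.1.count) (z := p.2.count) hn i
    have a5 := left_add_slide (y := p.1.count) (z := p.2.count) hn (i + 1)
    have a6 := right_add_slide (y := p.1.count) (z := p.2.count) hn (i + 1)
    have a7 := moved_add (y := p.1.count) (z := p.2.count) hn i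
    have a8 := displaced_add (y := p.1.count) (z := p.2.count) hn (i + 1)
    have a9 := hb.sum_eq
    have b1 := hb (i + 1)
    rw [if_neg h2, if_pos rfl] at b1
    omega

/-- The slides change only at i + 1, by +1, 0 or -1 according to the factors acted on. This changes
the swapped rows only at i and i + 1, in the way required. -/
theorem rowSwap_e (hn : 1 < n) {i : ZMod n} {p q : KRTensor n l l'} (h : e i p = some q) :
    e i (rowSwap hn p) = some (rowSwap hn q) := by
  have hm : ∀ r, moved p.1.count p.2.count r + slide p (r + 1) = p.1.count r + slide p r :=
    fun r => moved_add hn r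
  have hd : ∀ r, displaced p.1.count p.2.count r + slide p r = p.2.count r + slide p (r + 1) :=
    fun r => displaced_add hn r
  have hm' : ∀ r, moved q.1.count q.2.count r + slide q (r + 1) = q.1.count r + slide q r :=
    fun r => moved_add hn r
  have hd' : ∀ r, displaced q.1.count q.2.count r + slide q r = q.2.count r + slide q (r + 1) :=
    fun r => displaced_add hn r
  have hs : ∀ r, r ≠ i + 1 → slide q r = slide p r := fun r hr => slide_of_e hn h hr
  have same (h0 : slide q (i + 1) = slide p (i + 1)) (r : ZMod n) :
      slide q r = slide p r := by
    by_cases hr : r = i + 1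
    · rw [hr, h0]
    · exact hs r hr
  rw [e_eq_some_iff hn]
  by_cases hla : ActsLeft i p <;> by_cases hl : ActsLeft i (rowSwap hn p)
  · have up (r : ZMod n) : slide q r = slide p r + (if r = i + 1 then 1 else 0) := by
      by_cases hr : r = i + 1
      · rw [hr, if_pos rfl, slide_left_left hn h hla hl]
      · rw [if_neg hr, hs r hr, add_zero]
    rcases (e_eq_some_iff hn).1 h with ⟨_, hb, e2⟩ | ⟨h0, _⟩
    · refine Or.inl ⟨hl, fun r => ?_, KRRow.ext_count fun r => ?_⟩
      · have := hd r; have := hd' r; have := up r; have := up (r + 1)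
        have : q.2.count r = p.2.count r := by rw [e2]
        simp only [add_left_inj] at *
        change displaced _ _ _ + _ = displaced _ _ _ + _
        omega
      · have := hm r; have := hm' r; have := up r; have := up (r + 1); have := hb r
        have : q.2.count r = p.2.count r := by rw [e2]
        simp only [add_left_inj] at *
        change moved _ _ _ = moved _ _ _
        omega
    · exact absurd hla (not_lt.2 h0)
  · have up := same (slide_left_right hn h hla hl)
    rcases (e_eq_some_iff hn).1 h with ⟨_, hb, e2⟩ | ⟨h0, _⟩
    · refine Or.inr ⟨not_lt.1 hl, fun r => ?_, KRRow.ext_count fun r => ?_⟩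
      · have := hm r; have := hm' r; have := up r; have := up (r + 1); have := hb r
        change moved _ _ _ + _ = moved _ _ _ + _
        omega
      · have := hd r; have := hd' r; have := up r; have := up (r + 1)
        have : q.2.count r = p.2.count r := by rw [e2]
        change displaced _ _ _ = displaced _ _ _
        omega
    · exact absurd hla (not_lt.2 h0)
  · have up := same ((slide_right_cases hn h hla).2 hl)
    rcases (e_eq_some_iff hn).1 h with ⟨h0, _⟩ | ⟨_, hb, e1⟩
    · exact absurd h0 hla
    · refine Or.inl ⟨hl, fun r => ?_, KRRow.ext_count fun r => ?_⟩
      · have := hd r; have := hd' r; have := up r; have := up (r + 1); have := hb r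
        change displaced _ _ _ + _ = displaced _ _ _ + _
        omega
      · have := hm r; have := hm' r; have := up r; have := up (r + 1)
        have : q.1.count r = p.1.count r := by rw [e1]
        change moved _ _ _ = moved _ _ _
        omega
  · have up (r : ZMod n) : slide q r + (if r = i + 1 then 1 else 0) = slide p r := by
      by_cases hr : r = i + 1
      · rw [hr, if_pos rfl, (slide_right_cases hn h hla).1 hl]
      · rw [if_neg hr, hs r hr, add_zero]
    rcases (e_eq_some_iff hn).1 h with ⟨h0, _⟩ | ⟨_, hb, e1⟩
    · exact absurd h0 hla
    · refine Or.inr ⟨not_lt.1 hl, fun r => ?_, KRRow.ext_count fun r => ?_⟩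
      · have := hm r; have := hm' r; have := up r; have := up (r + 1)
        have : q.1.count r = p.1.count r := by rw [e1]
        simp only [add_left_inj] at *
        change moved _ _ _ + _ = moved _ _ _ + _
        omega
      · have := hd r; have := hd' r; have := up r; have := up (r + 1); have := hb r
        have : q.1.count r = p.1.count r := by rw [e1]
        simp only [add_left_inj] at *
        change displaced _ _ _ = displaced _ _ _
        omega

theorem eps_rowSwap (hn : 1 < n) (i : ZMod n) (p : KRTensor n l l') :
    eps i (rowSwap hn p) = eps i p := by
  have h1 := min_displaced_moved (y := p.1.count) (z := p.2.count) hn i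
  have h2 := moved_add (y := p.1.count) (z := p.2.count) hn (i + 1)
  have h3 := displaced_add (y := p.1.count) (z := p.2.count) hn (i + 1)
  change moved _ _ _ + (displaced _ _ _ - moved _ _ _) =
    p.2.count (i + 1) + (p.1.count (i + 1) - p.2.count i)
  omega

theorem phi_rowSwap (hn : 1 < n) (i : ZMod n) (p : KRTensor n l l') :
    phi i (rowSwap hn p) = phi i p := by
  have h1 := min_displaced_moved (y := p.1.count) (z := p.2.count) hn i
  have h2 := moved_add (y := p.1.count) (z := p.2.count) hn i
  have h3 := displaced_add (y := p.1.count) (z := p.2.count) hn i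
  change displaced _ _ _ + (moved _ _ _ - displaced _ _ _) =
    p.1.count i + (p.2.count i - p.1.count (i + 1))
  omega

/-- The differences φ - ε fix the total letter counts up to a common constant, the total length
fixes the constant, and the resulting weight has no letter other than 1. -/
theorem eq_top_of_weight {p : KRTensor n l' l}
    (he : ∀ i, eps i p = eps i (KRRow.top n l, KRRow.top n l'))
    (hp : ∀ i, phi i p = phi i (KRRow.top n l, KRRow.top n l')) :
    p = (KRRow.top n l', KRRow.top n l) := by
  obtain ⟨a, b⟩ := p
  set t := KRRow.top n l with ht
  set t' := KRRow.top n l' with ht'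
  have h : ∀ i : ZMod n, a.count i + b.count i + (t.count (i + 1) + t'.count (i + 1)) =
      a.count (i + 1) + b.count (i + 1) + (t.count i + t'.count i) := by
    intro i
    have h1 := he i
    have h2 := hp i
    simp only [eps, phi, KRRow.eps, KRRow.phi] at h1 h2
    omega
  have h' : ∀ s : ℕ, a.count (1 + s) + b.count (1 + s) + (t.count 1 + t'.count 1) =
      a.count 1 + b.count 1 + (t.count (1 + s) + t'.count (1 + s)) := by
    intro s
    induction s with
    | zero => simp
    | succ s ih =>
      have := h (1 + s)
      simp only [Nat.cast_succ, ← add_assoc]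
      omega
  have h'' : ∀ r, a.count r + b.count r + (t.count 1 + t'.count 1) =
      a.count 1 + b.count 1 + (t.count r + t'.count r) := by
    intro r
    have := h' (r - 1).val
    simpa using this
  have hsum := Finset.sum_congr rfl fun r (_ : r ∈ univ) => h'' r
  simp only [Finset.sum_add_distrib, KRRow.sum_count, Finset.sum_const] at hsum
  have hcard : 0 < #(univ : Finset (ZMod n)) := Finset.card_pos.2 univ_nonempty
  have hone : t.count 1 + t'.count 1 = a.count 1 + b.count 1 := by
    have : #(univ : Finset (ZMod n)) * (t.count 1 + t'.count 1) =
        #(univ : Finset (ZMod n)) * (a.count 1 + b.count 1) := by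
      simp only [smul_eq_mul, mul_add] at hsum ⊢
      omega
    exact Nat.eq_of_mul_eq_mul_left hcard this
  have hr : ∀ r, r ≠ 1 → a.count r = 0 ∧ b.count r = 0 := by
    intro r hr
    have h1 := h'' r
    have h2 : t.count r = 0 := top_apply_of_ne hr
    have h3 : t'.count r = 0 := top_apply_of_ne hr
    omega
  rw [eq_top_of_forall a fun r h => (hr r h).1, eq_top_of_forall b fun r h => (hr r h).2]

theorem rowSwap_top (hn : 1 < n) :
    rowSwap hn (KRRow.top n l, KRRow.top n l') = (KRRow.top n l', KRRow.top n l) :=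
  eq_top_of_weight (fun i => eps_rowSwap hn i _) (fun i => phi_rowSwap hn i _)

/-- The fixed points of the double swap contain the top element and are closed under the arrows in
both directions; connectedness does the rest. This also yields bijectivity. -/
theorem rowSwap_rowSwap (hn : 1 < n) (p : KRTensor n l l') :
    rowSwap hn (rowSwap hn p) = p := by
  refine connected hn (P := fun p => rowSwap hn (rowSwap hn p) = p)
    (by rw [rowSwap_top, rowSwap_top]) ?_ p
  intro i p q h
  have h2 := rowSwap_e hn (rowSwap_e hn h)
  constructor
  · intro hp
    rw [hp, h] at h2
    exact (Option.some.inj h2).symm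
  · intro hq
    rw [hq, ← f_eq_some_iff hn, (f_eq_some_iff hn).2 h] at h2
    exact (Option.some.inj h2).symm

/-- The piecewise linear `R`-matrix as a bijection. -/
def rowSwapEquiv (hn : 1 < n) (l l' : ℕ) : KRTensor n l l' ≃ KRTensor n l' l where
  toFun := rowSwap hn
  invFun := rowSwap hn
  left_inv := rowSwap_rowSwap hn
  right_inv := rowSwap_rowSwap hn

theorem isCrystalIso_rowSwapEquiv (hn : 1 < n) : IsCrystalIso (rowSwapEquiv (n := n) hn l l') where
  map_e i p := by
    change e i (rowSwap hn p) = _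
    cases h : e i p with
    | none =>
      rw [e_eq_none_iff hn] at h
      rw [Option.map_none, e_eq_none_iff hn, eps_rowSwap, h]
    | some q => rw [rowSwap_e hn h]; rfl
  map_f i p := by
    change f i (rowSwap hn p) = _
    ext q
    rw [f_eq_some_iff hn, Option.map_eq_some_iff]
    constructor
    · intro h
      have := rowSwap_e hn h
      rw [rowSwap_rowSwap] at this
      exact ⟨rowSwap hn q, (f_eq_some_iff hn).2 this, rowSwap_rowSwap hn q⟩
    · rintro ⟨q', h, rfl⟩
      exact rowSwap_e hn ((f_eq_some_iff hn).1 h)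
  map_eps i p := eps_rowSwap hn i p
  map_phi i p := phi_rowSwap hn i p

theorem IsCrystalIso.unique (hn : 1 < n) {R R' : KRTensor n l l' ≃ KRTensor n l' l}
    (h : IsCrystalIso R) (h' : IsCrystalIso R') (p : KRTensor n l l') : R p = R' p := by
  refine connected hn (P := fun p => R p = R' p) ?_ ?_ p
  · rw [eq_top_of_weight (fun i => h.map_eps i _) (fun i => h.map_phi i _),
      eq_top_of_weight (fun i => h'.map_eps i _) (fun i => h'.map_phi i _)]
  · intro i p q hq
    have h1 := h.map_e i p
    have h2 := h'.map_e i p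
    rw [hq, Option.map_some] at h1 h2
    constructor
    · intro e
      rw [e, h2] at h1
      exact (Option.some.inj h1).symm
    · intro e
      rw [← f_eq_some_iff hn] at h1 h2
      rw [e, h2] at h1
      exact (Option.some.inj h1).symm

end KRTensor

/-! ### The `R`-matrix and the coenergy as sliding formulas. -/

section Uniqueness

variable {n : ℕ} [NeZero n] {l l' : ℕ}

theorem combR_eq_rowSwap (hn : 1 < n) (p : KRTensor n l l') :
    combR n l l' p = KRTensor.rowSwap hn p := by
  have hex : ∃ R : KRTensor n l l' ≃ KRTensor n l' l, KRTensor.IsCrystalIso R :=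
    ⟨_, KRTensor.isCrystalIso_rowSwapEquiv hn⟩
  rw [combR, dif_pos hex]
  exact hex.choose_spec.unique hn (KRTensor.isCrystalIso_rowSwapEquiv hn) p

theorem slide_top (hn : 1 < n) :
    KRTensor.slide (KRRow.top n l, KRRow.top n l') 1 = 0 := by
  refine Nat.le_zero.1 ((RowSlide.slide_le (s := 0) (by omega)).trans (le_of_eq ?_))
  rw [RowSlide.term, Finset.range_zero, Finset.sum_empty, zero_add]
  refine Finset.sum_eq_zero fun t ht => KRTensor.top_apply_of_ne fun h => ?_
  rw [Finset.mem_Ico] at ht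
  refine natCast_ne_zero_zmod (n := n) (s := t + 1) (by omega) (by omega) ?_
  push_cast
  linear_combination h

theorem isLocalCoenergy_slide (hn : 1 < n) :
    IsLocalCoenergy fun p : KRTensor n l l' => (KRTensor.slide p 1 : ℤ) where
  top := by rw [slide_top hn]; rfl
  classical i hi p q h := by
    rw [KRTensor.slide_of_e hn h fun h1 => hi (by linear_combination -h1)]
  left_left p q h h1 h2 := by
    rw [combR_eq_rowSwap hn] at h2
    have := KRTensor.slide_left_left hn h h1 h2
    rw [zero_add] at this
    rw [this]; push_cast; rfl
  right_right p q h h1 h2 := by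
    rw [combR_eq_rowSwap hn] at h2
    have := (KRTensor.slide_right_cases hn h h1).1 h2
    rw [zero_add] at this
    omega
  mixed p q h h1 := by
    rw [combR_eq_rowSwap hn] at h1
    by_cases ha : KRTensor.ActsLeft 0 p
    · have := KRTensor.slide_left_right hn h ha (by tauto)
      rw [zero_add] at this
      rw [this]
    · have := (KRTensor.slide_right_cases hn h ha).2 (by tauto)
      rw [zero_add] at this
      rw [this]

theorem IsLocalCoenergy.unique (hn : 1 < n) {H H' : KRTensor n l l' → ℤ}
    (h : IsLocalCoenergy H) (h' : IsLocalCoenergy H') (p : KRTensor n l l') : H p = H' p := by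
  refine KRTensor.connected hn (P := fun p => H p = H' p) (by rw [h.top, h'.top]) ?_ p
  intro i p q hq
  by_cases hi : i = 0
  · subst hi
    by_cases h1 : KRTensor.ActsLeft 0 p <;> by_cases h2 : KRTensor.ActsLeft 0 (combR n l l' p)
    · rw [h.left_left p q hq h1 h2, h'.left_left p q hq h1 h2, add_left_inj]
    · rw [h.mixed p q hq (by tauto), h'.mixed p q hq (by tauto)]
    · rw [h.mixed p q hq (by tauto), h'.mixed p q hq (by tauto)]
    · rw [h.right_right p q hq h1 h2, h'.right_right p q hq h1 h2, sub_left_inj]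
  · rw [h.classical i hi p q hq, h'.classical i hi p q hq]

theorem localCoenergy_eq_slide (hn : 1 < n) (p : KRTensor n l l') :
    localCoenergy n l l' p = (KRTensor.slide p 1 : ℤ) := by
  have hex : ∃ H : KRTensor n l l' → ℤ, IsLocalCoenergy H := ⟨_, isLocalCoenergy_slide hn⟩
  rw [localCoenergy, dif_pos hex]
  exact hex.choose_spec.unique hn (isLocalCoenergy_slide hn) p

end Uniqueness

/-! ### The birational `R`-matrix -/

section KernelSeq

variable {n : ℕ} {K : Type*}

/-- The sequences annihilated by the operator `u ↦ (k ↦ u k - a k * u (k + 1))`. -/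
def IsKernelSeq [CommSemiring K] (a : ZMod n → K) (u : ℤ → K) : Prop :=
  ∀ k : ℤ, u k = a k * u (k + 1)

/-- The product of `a` over an interval of integers. -/
noncomputable def intervalProd [CommMonoid K] (a : ZMod n → K) (p q : ℤ) : K := ∏ k ∈ Ico p q, a (k : ZMod n)

theorem IsKernelSeq.eq_intervalProd_mul [CommSemiring K] {a : ZMod n → K} {u : ℤ → K}
    (h : IsKernelSeq a u) {p q : ℤ} (hpq : p ≤ q) : u p = intervalProd a p q * u q := by
  induction q, hpq using Int.leInduction with
  | base => simp [intervalProd]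
  | succ q hq ih =>
    rw [ih, h q, intervalProd, intervalProd, ← Finset.insert_Ico_right_eq_Ico_add_one hq,
      Finset.prod_insert (by simp)]
    ring

end KernelSeq

section Birational

variable {n : ℕ} [NeZero n] {K : Type*}

/-- The subtraction-free lift of the sliding number. -/
def geomSlide [CommSemiring K] (a b : ZMod n → K) (k : ZMod n) : K :=
  ∑ s ∈ range n, (∏ t ∈ range s, b (k + t)) * ∏ t ∈ Ico s (n - 1), a (k + t)

/-- The row that the birational `R`-matrix moves from the left to the right. -/
def geomMoved [Semifield K] (a b : ZMod n → K) (k : ZMod n) : K :=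
  a (k - 1) * geomSlide a b k / geomSlide a b (k + 1)

/-- The two products are the sums of F s and of F (s + 1) over s < n, the multiplicative
counterparts of `left_add_term` and `right_add_term`. Compared with `RowSlide.term`, the index of
the left row is shifted by one. -/
theorem geomSlide_telescope [CommRing K] (a b : ZMod n → K) (k : ZMod n) :
    a (k - 1) * geomSlide a b k - b k * geomSlide a b (k + 1) = ∏ r, a r - ∏ r, b r := by
  set F : ℕ → K := fun s => (∏ t ∈ range s, b (k + t)) * ∏ t ∈ Ico s n, a (k + t) with hF
  have hpos := NeZero.pos n
  have h1 : a (k - 1) * geomSlide a b k = ∑ s ∈ range n, F s := by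
    rw [geomSlide, Finset.mul_sum]
    refine Finset.sum_congr rfl fun s hs => ?_
    rw [mem_range] at hs
    have : ∏ t ∈ Ico s n, a (k + t) = (∏ t ∈ Ico s (n - 1), a (k + t)) * a (k - 1) := by
      have hk : k + ((n - 1 : ℕ) : ZMod n) = k - 1 := by
        rw [Nat.cast_sub hpos]; simp [sub_eq_add_neg]
      obtain ⟨m, rfl⟩ : ∃ m, n = m + 1 := ⟨n - 1, by omega⟩
      rw [Finset.prod_Ico_succ_top (by omega)]
      simp only [Nat.add_sub_cancel] at hk ⊢
      rw [hk]
    simp only [hF]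
    rw [this]
    ring
  have h2 : b k * geomSlide a b (k + 1) = ∑ s ∈ range n, F (s + 1) := by
    rw [geomSlide, Finset.mul_sum]
    refine Finset.sum_congr rfl fun s hs => ?_
    have e1 : ∏ t ∈ range (s + 1), b (k + t) = (∏ t ∈ range s, b (k + 1 + t)) * b k := by
      rw [Finset.prod_range_succ']
      simp [add_assoc, add_comm (1 : ZMod n)]
    have e2 : ∏ t ∈ Ico (s + 1) n, a (k + t) = ∏ t ∈ Ico s (n - 1), a (k + 1 + t) := by
      obtain ⟨m, rfl⟩ : ∃ m, n = m + 1 := ⟨n - 1, by omega⟩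
      rw [← Finset.prod_Ico_add' (fun t : ℕ => a (k + t))]
      simp [add_assoc, add_comm (1 : ZMod (m + 1))]
    simp only [hF]
    rw [e1, e2]
    ring
  rw [h1, h2, ← Finset.sum_sub_distrib, Finset.sum_range_sub']
  simp [hF, prod_range_zmod]

theorem prod_geomMoved [Field K] {a b : ZMod n → K} (h : ∀ k, geomSlide a b k ≠ 0) :
    ∏ r, geomMoved a b r = ∏ r, a r := by
  simp only [geomMoved, Finset.prod_div_distrib, Finset.prod_mul_distrib]
  have h1 : ∏ r, a (r - 1) = ∏ r, a r := Equiv.prod_comp (Equiv.subRight (1 : ZMod n)) a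
  have h2 : ∏ r, geomSlide a b (r + 1) = ∏ r, geomSlide a b r :=
    Equiv.prod_comp (Equiv.addRight (1 : ZMod n)) (geomSlide a b)
  rw [h1, h2, mul_div_assoc, div_self (Finset.prod_ne_zero_iff.2 fun r _ => h r), mul_one]

theorem exists_isKernelSeq [Field K] {a : ZMod n → K} (ha : ∀ r, a r ≠ 0) :
    ∃ u : ℤ → K, IsKernelSeq a u ∧ ∀ k, u k ≠ 0 := by
  refine ⟨fun k => match k with
    | .ofNat s => (∏ t ∈ range s, a t)⁻¹
    | .negSucc s => ∏ t ∈ range (s + 1), a (-1 - t), ?_, ?_⟩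
  · rintro (s | s)
    · change (∏ t ∈ range s, a t)⁻¹ = a ((s : ℤ) : ZMod n) * (∏ t ∈ range (s + 1), a t)⁻¹
      have := ha s
      rw [Finset.prod_range_succ, Int.cast_natCast]
      field_simp
    · rcases s with - | s
      · change ∏ t ∈ range 1, a (-1 - t) = a ((-1 : ℤ) : ZMod n) * (∏ t ∈ range 0, a t)⁻¹
        simp
      · change ∏ t ∈ range (s + 1 + 1), a (-1 - t) =
          a ((Int.negSucc (s + 1) : ℤ) : ZMod n) * ∏ t ∈ range (s + 1), a (-1 - t)
        rw [Finset.prod_range_succ, mul_comm]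
        congr 2
        push_cast
        ring
  · rintro (s | s)
    · exact inv_ne_zero (Finset.prod_ne_zero_iff.2 fun t _ => ha _)
    · exact Finset.prod_ne_zero_iff.2 fun t _ => ha _

/-- One turn around the cycle multiplies a kernel sequence by the product of the row. These
monodromies become the Vandermonde variables. -/
theorem IsKernelSeq.sub_period [CommSemiring K] {a : ZMod n → K} {u : ℤ → K}
    (h : IsKernelSeq a u) (k : ℤ) : u (k - n) = (∏ r, a r) * u k := by
  have key : ∀ s : ℕ, u (k - n) = (∏ t ∈ range s, a (((k - n : ℤ) : ZMod n) + t)) *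
      u (k - n + s) := by
    intro s
    induction s with
    | zero => simp
    | succ s ih =>
      rw [ih, h (k - n + s), Finset.prod_range_succ]
      push_cast
      rw [← add_assoc (k - n : ℤ)]
      ring
  rw [key n, prod_range_zmod, sub_add_cancel]

theorem IsKernelSeq.sub_mul_period [CommSemiring K] {a : ZMod n → K} {u : ℤ → K}
    (h : IsKernelSeq a u) (k : ℤ) (s : ℕ) : u (k - n * s) = (∏ r, a r) ^ s * u k := by
  induction s with
  | zero => simp
  | succ s ih =>
    have := h.sub_period (k - n * s)
    rw [ih] at this
    rw [pow_succ', mul_assoc, ← this]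
    congr 1
    push_cast
    ring

/-- The factor `geomSlide` absorbs the quotient in the definition of `geomMoved`, and the shift of u
absorbs a (k - 1). -/
theorem IsKernelSeq.geomMoved [Field K] {a b : ZMod n → K} {u : ℤ → K} (h : IsKernelSeq a u)
    (hs : ∀ k, geomSlide a b k ≠ 0) :
    IsKernelSeq (geomMoved a b) fun k => u (k - 1) * geomSlide a b k := by
  intro k
  have := h (k - 1)
  have h0 := hs ((k : ZMod n) + 1)
  push_cast at this ⊢
  rw [this, _root_.geomMoved]
  simp only [sub_add_cancel, add_sub_cancel_right]
  field_simp

/-- The intertwining relation behind the determinant recursion: undoing the last move costs only a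
scalar. It is `geomSlide_telescope` times u k. -/
theorem IsKernelSeq.geomMoved_sub [CommRing K] {a b : ZMod n → K} {u : ℤ → K}
    (h : IsKernelSeq a u) (k : ℤ) :
    u (k - 1) * geomSlide a b k - b k * (u (k + 1 - 1) * geomSlide a b ((k + 1 : ℤ) : ZMod n)) =
      (∏ r, a r - ∏ r, b r) * u k := by
  have h1 := h (k - 1)
  have h2 := geomSlide_telescope a b (k : ZMod n)
  push_cast at h1 ⊢
  rw [← h2, h1]
  simp only [sub_add_cancel, add_sub_cancel_right]
  ring

end Birational

/-! ### Determinants and Gelfand-Tsetlin sums -/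

section GelfandTsetlin

variable {n : ℕ} {K : Type*}

/-- The sum over Gelfand-Tsetlin patterns with top row `α`. -/
noncomputable def gtSum [CommSemiring K] (x : ℕ → ZMod n → K) : (m : ℕ) → (Fin m → ℤ) → K
  | 0, _ => 1
  | m + 1, α =>
    ∑ β ∈ Fintype.piFinset fun i : Fin m => Ico (α i.castSucc) (α i.succ),
      (∏ i, intervalProd (x m) (α i.castSucc) (β i)) *
        intervalProd (x m) (α (Fin.last m)) (m + 1) * gtSum x m β

theorem det_kernel_column [Field K] {m : ℕ} {a : ZMod n → K} {v : Fin (m + 1) → ℤ → K}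
    {u : Fin m → ℤ → K} (hlast : IsKernelSeq a (v (Fin.last m)))
    (hne : ∀ k, v (Fin.last m) k ≠ 0)
    (hu : ∀ j k, v (Fin.castSucc j) k - a k * v (Fin.castSucc j) (k + 1) = u j k)
    {α : Fin (m + 1) → ℤ} (hα : Monotone α) :
    Matrix.det (Matrix.of fun i j => v j (α i)) =
      ∑ β ∈ Fintype.piFinset fun i : Fin m => Ico (α i.castSucc) (α i.succ),
        (∏ i, intervalProd a (α i.castSucc) (β i)) * v (Fin.last m) (α (Fin.last m)) *
          Matrix.det (Matrix.of fun i j => u j (β i)) := by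
  set E := v (Fin.last m) with hE
  have h1 : Matrix.det (Matrix.of fun i j => v j (α i)) =
      (∏ i, E (α i)) * Matrix.det (Matrix.of fun i j => v j (α i) / E (α i)) := by
    rw [← Matrix.det_mul_column]
    congr 1
    ext i j
    simp only [Matrix.of_apply]
    rw [mul_div_cancel₀ _ (hne _)]
  have h2 : Matrix.det (Matrix.of fun i j => v j (α i) / E (α i)) =
      Matrix.det (Matrix.of (Fin.cons (fun j => v j (α 0) / E (α 0))
        fun (i : Fin m) j => v j (α i.succ) / E (α i.succ) -
          v j (α i.castSucc) / E (α i.castSucc))) := by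
    refine Matrix.det_eq_of_forall_row_eq_smul_add_pred (fun _ => 1) ?_ ?_
    · intro j; simp
    · intro i j; simp
  have h3 : Matrix.det (Matrix.of (Fin.cons (fun j => v j (α 0) / E (α 0))
        fun (i : Fin m) j => v j (α i.succ) / E (α i.succ) -
          v j (α i.castSucc) / E (α i.castSucc))) =
      Matrix.det (Matrix.of fun i j : Fin m => v j.castSucc (α i.castSucc) / E (α i.castSucc) -
        v j.castSucc (α i.succ) / E (α i.succ)) := by
    rw [Matrix.det_succ_column _ (Fin.last m), Fin.sum_univ_succ, Finset.sum_eq_zero]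
    -- The row differences have the sign opposite to the one wanted; the resulting (-1) ^ m cancels
    -- the cofactor sign of the last column.
    · have : Matrix.submatrix (Matrix.of (Fin.cons (fun j => v j (α 0) / E (α 0))
        fun (i : Fin m) j => v j (α i.succ) / E (α i.succ) -
          v j (α i.castSucc) / E (α i.castSucc))) (Fin.succAbove 0) (Fin.succAbove (Fin.last m)) =
          -(Matrix.of fun i j : Fin m => v j.castSucc (α i.castSucc) / E (α i.castSucc) -
            v j.castSucc (α i.succ) / E (α i.succ)) := by
        ext i j
        simp
      rw [this, Matrix.det_neg]
      simp only [Matrix.of_apply, Fin.cons_zero, Fintype.card_fin, Fin.val_zero, zero_add,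
        Fin.val_last, add_zero]
      rw [← hE, div_self (hne _), mul_one, ← mul_assoc, ← pow_add, Even.neg_one_pow ⟨m, rfl⟩,
        one_mul]
    · intro i _
      simp only [Matrix.of_apply, Fin.cons_succ]
      rw [← hE, div_self (hne _), div_self (hne _)]
      simp
  have h4 : (Matrix.of fun i j : Fin m => v j.castSucc (α i.castSucc) / E (α i.castSucc) -
        v j.castSucc (α i.succ) / E (α i.succ)) =
      fun i => ∑ b ∈ Ico (α i.castSucc) (α i.succ), fun j => u j b / E b := by
    funext i j
    rw [Finset.sum_apply, Matrix.of_apply]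
    have hle : α i.castSucc ≤ α i.succ := hα (Fin.castSucc_lt_succ).le
    generalize α i.castSucc = p at *
    generalize α i.succ = q at *
    induction q, hle using Int.leInduction with
    | base => simp
    | succ q hq ih =>
      rw [← Finset.insert_Ico_right_eq_Ico_add_one hq, Finset.sum_insert (by simp), ← ih, ← hu,
        hlast q]
      have e1 := hne q
      rw [hlast q] at e1
      have e2 := right_ne_zero_of_mul e1
      have e3 := left_ne_zero_of_mul e1
      rw [← hE] at *
      field_simp
      ring
  have h5 : Matrix.det (fun i => ∑ b ∈ Ico (α i.castSucc) (α i.succ), fun j : Fin m => u j b / E b)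
      = ∑ β ∈ Fintype.piFinset fun i : Fin m => Ico (α i.castSucc) (α i.succ),
        (∏ i, (E (β i))⁻¹) * Matrix.det (Matrix.of fun i j => u j (β i)) := by
    have := (Matrix.detRowAlternating (n := Fin m) (R := K)).toMultilinearMap.map_sum_finset
      (fun (i : Fin m) (b : ℤ) => fun j : Fin m => u j b / E b)
      (fun i : Fin m => Ico (α i.castSucc) (α i.succ))
    refine this.trans (Finset.sum_congr rfl fun β _ => ?_)
    rw [← Matrix.det_mul_column]
    change Matrix.det _ = _
    congr 1
    ext i j
    simp [div_eq_inv_mul]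
  rw [h1, h2, h3, h4, h5, Finset.mul_sum]
  refine Finset.sum_congr rfl fun β hβ => ?_
  rw [Fin.prod_univ_castSucc, ← mul_assoc]
  congr 1
  rw [mul_right_comm]
  congr 1
  rw [← Finset.prod_mul_distrib]
  refine Finset.prod_congr rfl fun i _ => ?_
  have hb := Fintype.mem_piFinset.1 hβ i
  rw [Finset.mem_Ico] at hb
  rw [hlast.eq_intervalProd_mul hb.1, mul_assoc, mul_inv_cancel₀ (hne _), mul_one]

/-- Each application of `det_kernel_column` turns stage m + 1 into stage m, with the scalars q j m
pulled out of the columns. The bound on α passes to β because β i < α (i + 1). -/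
theorem det_eq_gtSum [Field K] {x : ℕ → ZMod n → K} {w : ℕ → ℕ → ℤ → K} {q : ℕ → ℕ → K}
    (hker : ∀ m, IsKernelSeq (x m) (w (m + 1) m)) (hne : ∀ m k, w (m + 1) m k ≠ 0)
    (hw : ∀ m j, j < m → ∀ k : ℤ,
      w (m + 1) j k - x m k * w (m + 1) j (k + 1) = q j m * w m j k) :
    ∀ (m : ℕ) {α : Fin m → ℤ}, Monotone α → (∀ i : Fin m, α i ≤ m) →
      Matrix.det (Matrix.of fun i j : Fin m => w m j (α i)) =
        gtSum x m α * (∏ j ∈ range m, w (j + 1) j (j + 1)) *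
          ∏ t ∈ range m, ∏ j ∈ range t, q j t := by
  intro m
  induction m with
  | zero => intro α _ _; simp [gtSum]
  | succ m ih =>
    intro α hα hle
    rw [det_kernel_column (v := fun j : Fin (m + 1) => w (m + 1) j) (a := x m)
      (u := fun j : Fin m => fun k => q j m * w m j k) (by simpa using hker m)
      (by simpa using hne m) (fun j k => by simpa using hw m j j.2 k) hα, gtSum,
      Finset.sum_mul, Finset.sum_mul]
    refine Finset.sum_congr rfl fun β hβ => ?_
    have hb : ∀ i : Fin m, α i.castSucc ≤ β i ∧ β i < α i.succ := fun i => by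
      simpa using Fintype.mem_piFinset.1 hβ i
    have hmono : Monotone β := by
      intro i j hij
      rcases hij.eq_or_lt with rfl | hlt
      · exact le_rfl
      · have h1 : α i.succ ≤ α j.castSucc := hα (by
          rw [Fin.le_def]; simp; omega)
        have := hb i
        have := hb j
        omega
    have hle' : ∀ i, β i ≤ m := fun i => by
      have h1 := hb i
      have h2 := hle i.succ
      push_cast at h2
      omega
    have hdet : Matrix.det (Matrix.of fun i j : Fin m => q j m * w m j (β i)) =
        (∏ j ∈ range m, q j m) * Matrix.det (Matrix.of fun i j : Fin m => w m j (β i)) := by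
      rw [← Fin.prod_univ_eq_prod_range (fun j => q j m), ← Matrix.det_mul_row]
      rfl
    rw [hdet, ih hmono hle', Finset.prod_range_succ (fun j => w (j + 1) j (j + 1)),
      Finset.prod_range_succ (fun t => ∏ j ∈ range t, q j t)]
    -- Moving the evaluation point to m + 1 produces the last factor of `gtSum` and a normalization
    -- independent of α.
    have hl := (hker m).eq_intervalProd_mul (hle (Fin.last m))
    simp only [Fin.val_last]
    rw [hl]
    push_cast
    ring

theorem prod_range_range_eq_prod_fin [CommMonoid K] (m : ℕ) (g : ℕ → ℕ → K) :
    ∏ t ∈ range m, ∏ j ∈ range t, g j t =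
      ∏ j : Fin m, ∏ t : Fin m, if j < t then g j t else 1 := by
  rw [Finset.prod_comm, ← Fin.prod_univ_eq_prod_range (fun t => ∏ j ∈ range t, g j t)]
  refine Finset.prod_congr rfl fun t _ => ?_
  simp only [Fin.lt_def]
  rw [Fin.prod_univ_eq_prod_range (fun j => if j < (t : ℕ) then g j t else 1),
    ← Finset.prod_filter]
  congr 1
  ext j
  simp
  omega

end GelfandTsetlin

/-! ### The product of the sliding numbers is a Gelfand-Tsetlin sum -/

section SlideProduct

variable {n : ℕ} [NeZero n] {K : Type*}

/-- The row `x j` after it has been moved to the right past `d` rows. -/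
def geomMoveRight [Semifield K] (x : ℕ → ZMod n → K) (j : ℕ) : ℕ → ZMod n → K
  | 0 => x j
  | d + 1 => geomMoved (geomMoveRight x j d) (x (j + d + 1))

/-- The kernel sequence of the moved row that is determined by a kernel sequence of the row. -/
def kernelMoveRight [Semifield K] (x : ℕ → ZMod n → K) (u : ℕ → ℤ → K) (j : ℕ) : ℕ → ℤ → K
  | 0 => u j
  | d + 1 => fun k => kernelMoveRight x u j d (k - 1) *
      geomSlide (geomMoveRight x j d) (x (j + d + 1)) k

variable [Field K] [LinearOrder K] [IsStrictOrderedRing K]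

theorem geomSlide_pos {a b : ZMod n → K} (ha : ∀ r, 0 < a r) (hb : ∀ r, 0 < b r) (k : ZMod n) :
    0 < geomSlide a b k :=
  Finset.sum_pos (fun s _ => mul_pos (Finset.prod_pos fun t _ => hb _)
    (Finset.prod_pos fun t _ => ha _)) ⟨0, by simpa using NeZero.pos n⟩

theorem geomMoved_pos {a b : ZMod n → K} (ha : ∀ r, 0 < a r) (hb : ∀ r, 0 < b r) (k : ZMod n) :
    0 < geomMoved a b k :=
  div_pos (mul_pos (ha _) (geomSlide_pos ha hb _)) (geomSlide_pos ha hb _)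

theorem geomMoveRight_pos {x : ℕ → ZMod n → K} (hx : ∀ j r, 0 < x j r) (j d : ℕ) (r : ZMod n) :
    0 < geomMoveRight x j d r := by
  induction d generalizing r with
  | zero => exact hx j r
  | succ d ih => exact geomMoved_pos ih (hx _) r

theorem prod_geomMoveRight {x : ℕ → ZMod n → K} (hx : ∀ j r, 0 < x j r) (j d : ℕ) :
    ∏ r, geomMoveRight x j d r = ∏ r, x j r := by
  induction d with
  | zero => rfl
  | succ d ih =>
    exact (prod_geomMoved fun k =>
      (geomSlide_pos (geomMoveRight_pos hx j d) (hx _) k).ne').trans ih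

theorem isKernelSeq_kernelMoveRight {x : ℕ → ZMod n → K} (hx : ∀ j r, 0 < x j r)
    {u : ℕ → ℤ → K} (hu : ∀ j, IsKernelSeq (x j) (u j)) (j d : ℕ) :
    IsKernelSeq (geomMoveRight x j d) (kernelMoveRight x u j d) := by
  induction d with
  | zero => exact hu j
  | succ d ih =>
    exact ih.geomMoved fun k => (geomSlide_pos (geomMoveRight_pos hx j d) (hx _) k).ne'

/-- Each move shifts the argument by one, so evaluation just beyond the position of the row leads
back to u j (j + 1) and collects one slide per row passed. -/
theorem kernelMoveRight_apply {x : ℕ → ZMod n → K} (u : ℕ → ℤ → K) (j d : ℕ) :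
    kernelMoveRight x u j d (j + d + 1) = u j (j + 1) *
      ∏ t ∈ range d, geomSlide (geomMoveRight x j t) (x (j + t + 1))
        (((j + t + 1 : ℕ) : ZMod n) + 1) := by
  induction d with
  | zero => simp [kernelMoveRight]
  | succ d ih =>
    rw [Finset.prod_range_succ, ← mul_assoc, ← ih, kernelMoveRight]
    push_cast
    ring_nf

/-- The evaluation points are m minus multiples of n, so `sub_mul_period` exposes powers of the row
products. The hypothesis `hinj` lets the Vandermonde factor be cancelled. -/
theorem gtSum_eq_prod_geomSlide {x : ℕ → ZMod n → K} (hx : ∀ j r, 0 < x j r) (m : ℕ)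
    (hinj : ∀ i j, i < j → j < m → ∏ r, x i r ≠ ∏ r, x j r) :
    gtSum x m (fun i => (m : ℤ) - n * (m - 1 - i : ℕ)) =
      ∏ t ∈ range m, ∏ j ∈ range t,
        geomSlide (geomMoveRight x j (t - 1 - j)) (x t) ((t : ZMod n) + 1) := by
  choose u hu hne using fun j => exists_isKernelSeq (a := x j) fun r => (hx j r).ne'
  set p : ℕ → K := fun j => ∏ r, x j r with hp
  set w : ℕ → ℕ → ℤ → K := fun m j => kernelMoveRight x u j (m - 1 - j) with hw
  have hdet := det_eq_gtSum (x := x) (w := w) (q := fun j t => p j - p t)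
    (fun m => by simpa [hw, kernelMoveRight] using hu m)
    (fun m => by simpa [hw, kernelMoveRight] using hne m) (by
      intro m j hj k
      obtain ⟨d, rfl⟩ : ∃ d, m = j + d + 1 := ⟨m - 1 - j, by omega⟩
      have e1 : j + d + 1 + 1 - 1 - j = d + 1 := by omega
      have e2 : j + d + 1 - 1 - j = d := by omega
      simp only [hw, e1, e2, kernelMoveRight, hp]
      rw [← prod_geomMoveRight hx j d]
      exact (isKernelSeq_kernelMoveRight hx hu j d).geomMoved_sub k) m
    (α := fun i => (m : ℤ) - n * (m - 1 - i : ℕ)) (by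
      intro i j hij
      have : m - 1 - (j : ℕ) ≤ m - 1 - i := by
        have : (i : ℕ) ≤ j := hij
        omega
      exact sub_le_sub_left (mul_le_mul_of_nonneg_left (by exact_mod_cast this) (by positivity)) _) (by
      intro i
      have : (0 : ℤ) ≤ n * (m - 1 - i : ℕ) := by positivity
      linarith)
  -- The exponents m - 1 - i decrease with i. Hence the Vandermonde factors are p j - p t with j <
  -- t, as in `hdet`, and no sign appears.
  have hmat : (Matrix.of fun i j : Fin m => w m j ((m : ℤ) - n * (m - 1 - i : ℕ))) =
      Matrix.of fun i j : Fin m => w m j m *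
        (Matrix.projVandermonde (fun _ => 1) (fun i : Fin m => p i)).transpose i j := by
    ext i j
    simp only [Matrix.of_apply, Matrix.transpose_apply, Matrix.projVandermonde_apply, one_pow,
      one_mul, hw]
    rw [(isKernelSeq_kernelMoveRight hx hu j _).sub_mul_period, prod_geomMoveRight hx, mul_comm,
      Fin.val_rev]
    congr 2
    omega
  have hV : (Matrix.projVandermonde (fun _ => 1) (fun i : Fin m => p i)).det =
      ∏ t ∈ range m, ∏ j ∈ range t, (p j - p t) := by
    rw [Matrix.det_projVandermonde, prod_range_range_eq_prod_fin]
    refine Finset.prod_congr rfl fun i _ => ?_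
    rw [← Finset.prod_filter]
    refine Finset.prod_congr (by ext; simp) fun j _ => by ring
  have hV0 : ∏ t ∈ range m, ∏ j ∈ range t, (p j - p t) ≠ 0 :=
    Finset.prod_ne_zero_iff.2 fun t ht => Finset.prod_ne_zero_iff.2 fun j hj =>
      sub_ne_zero.2 (hinj j t (by simpa using hj) (by simpa using ht))
  have hcol : ∏ j : Fin m, w m j m = (∏ j ∈ range m, u j (j + 1)) *
      ∏ t ∈ range m, ∏ j ∈ range t,
        geomSlide (geomMoveRight x j (t - 1 - j)) (x t) ((t : ZMod n) + 1) := by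
    rw [prod_range_range_eq_prod_fin, ← Fin.prod_univ_eq_prod_range (fun j => u j (j + 1)),
      ← Finset.prod_mul_distrib]
    refine Finset.prod_congr rfl fun j _ => ?_
    obtain ⟨d, hd⟩ : ∃ d, m = j + d + 1 := ⟨m - 1 - j, by omega⟩
    have e1 : m - 1 - (j : ℕ) = d := by omega
    have e2 : (m : ℤ) = j + d + 1 := by omega
    simp only [hw, e1]
    rw [e2, kernelMoveRight_apply]
    congr 1
    simp only [Fin.lt_def]
    rw [Fin.prod_univ_eq_prod_range (fun t => if (j : ℕ) < t then
      geomSlide (geomMoveRight x j (t - 1 - j)) (x t) ((t : ZMod n) + 1) else 1),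
      ← Finset.prod_filter]
    refine Finset.prod_nbij (fun t => j + t + 1) ?_ ?_ ?_ ?_
    · intro t ht; simp at ht ⊢; omega
    · intro s _ t _ h; simp at h; exact h
    · intro t ht
      simp at ht
      exact ⟨t - 1 - j, by simp; omega, by simp; omega⟩
    · intro t _
      have : (j : ℕ) + t + 1 - 1 - j = t := by omega
      rw [this]
  rw [hmat, Matrix.det_mul_row, Matrix.det_transpose, hV, hcol] at hdet
  have hw1 : ∀ j, w (j + 1) j (j + 1) = u j (j + 1) := fun j => by simp [hw, kernelMoveRight]
  have hu0 : ∏ j ∈ range m, u j (j + 1) ≠ 0 := Finset.prod_ne_zero_iff.2 fun j _ => hne j _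
  simp only [hw1] at hdet
  have := mul_right_cancel₀ hV0 hdet
  rw [mul_comm (gtSum _ _ _)] at this
  exact (mul_left_cancel₀ hu0 this).symm

end SlideProduct

/-! ### Semistandard tableaux and Gelfand-Tsetlin patterns -/

section Tableaux

variable {n : ℕ} {K : Type*} [CommSemiring K] {μ ν : YoungDiagram} {m : ℕ}

/-- The weight of a filling in a loop Schur function. -/
def tableauWeight (x : ℕ → ZMod n → K) (μ : YoungDiagram) (T : ℕ → ℕ → ℕ) : K :=
  ∏ c ∈ μ.cells, x (T c.1 c.2) ((c.1 : ZMod n) - (c.2 : ZMod n))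

/-- The cells of a tableau with entries less than `m`. -/
def innerShape (m : ℕ) (T : SemistandardYoungTableau μ) : YoungDiagram where
  cells := μ.cells.filter fun c => T c.1 c.2 < m
  isLowerSet := by
    rintro ⟨i, j⟩ ⟨i', j'⟩ hle h
    simp only [Finset.coe_filter, YoungDiagram.mem_cells, Set.mem_ofPred_eq] at h ⊢
    obtain ⟨hi, hj⟩ : i' ≤ i ∧ j' ≤ j := hle
    refine ⟨μ.up_left_mem hi hj h.1, ?_⟩
    calc T i' j' ≤ T i j' := T.col_weak hi (μ.up_left_mem le_rfl hj h.1)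
      _ ≤ T i j := T.row_weak_of_le hj h.1
      _ < m := h.2

theorem mem_innerShape {T : SemistandardYoungTableau μ} {c : ℕ × ℕ} :
    c ∈ innerShape m T ↔ c ∈ μ ∧ T c.1 c.2 < m := by
  rw [← YoungDiagram.mem_cells, innerShape, Finset.mem_filter, YoungDiagram.mem_cells]

theorem SemistandardYoungTableau.le_apply (T : SemistandardYoungTableau μ) {i j : ℕ}
    (h : (i, j) ∈ μ) : i ≤ T i j := by
  induction i with
  | zero => exact Nat.zero_le _
  | succ i ih =>
    exact (ih (μ.up_left_mem (Nat.le_succ i) le_rfl h)).trans_lt (T.col_strict (Nat.lt_succ_self i) h)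

/-- `μ / ν` is a horizontal strip. -/
def IsHorizontalStrip (μ ν : YoungDiagram) : Prop :=
  ν ≤ μ ∧ ∀ i, μ.rowLen (i + 1) ≤ ν.rowLen i

theorem rowLen_le_of_le (h : ν ≤ μ) (i : ℕ) : ν.rowLen i ≤ μ.rowLen i := by
  by_contra hlt
  push Not at hlt
  have : (i, μ.rowLen i) ∈ ν := YoungDiagram.mem_iff_lt_rowLen.2 hlt
  exact lt_irrefl _ (YoungDiagram.mem_iff_lt_rowLen.1 (h this))

theorem eq_of_rowLen_eq (h : ∀ i, ν.rowLen i = μ.rowLen i) : ν = μ := by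
  ext ⟨i, j⟩
  rw [YoungDiagram.mem_cells, YoungDiagram.mem_cells, YoungDiagram.mem_iff_lt_rowLen,
    YoungDiagram.mem_iff_lt_rowLen, h]

theorem isHorizontalStrip_innerShape (T : BoundedSSYT μ (m + 1)) :
    IsHorizontalStrip μ (innerShape m T.1) := by
  refine ⟨fun c hc => (mem_innerShape.1 hc).1, fun i => ?_⟩
  by_contra hlt
  push Not at hlt
  set j := (innerShape m T.1).rowLen i with hj
  have h1 : (i + 1, j) ∈ μ := YoungDiagram.mem_iff_lt_rowLen.2 hlt
  have h2 : (i, j) ∈ innerShape m T.1 := by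
    rw [mem_innerShape]
    refine ⟨μ.up_left_mem (Nat.le_succ i) le_rfl h1, ?_⟩
    have h3 : T.1 i j < T.1 (i + 1) j := T.1.col_strict (Nat.lt_succ_self i) h1
    have h4 := T.2 (i + 1, j) ((YoungDiagram.mem_cells _).2 h1)
    simp only at h4 ⊢
    omega
  rw [YoungDiagram.mem_iff_lt_rowLen, ← hj] at h2
  exact lt_irrefl _ h2

theorem rowLen_innerShape_self (T : SemistandardYoungTableau μ) :
    (innerShape m T).rowLen m = 0 := by
  by_contra h
  have h1 : (m, 0) ∈ innerShape m T := YoungDiagram.mem_iff_lt_rowLen.2 (Nat.pos_of_ne_zero h)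
  rw [mem_innerShape] at h1
  have := T.le_apply h1.1
  simp only at h1
  omega

/-- The restriction of a tableau to a smaller shape. -/
def SemistandardYoungTableau.restrict (T : SemistandardYoungTableau μ) (h : ν ≤ μ) :
    SemistandardYoungTableau ν where
  entry i j := if (i, j) ∈ ν then T i j else 0
  row_weak' {i j1 j2} hj hc := by
    rw [if_pos hc, if_pos (ν.up_left_mem le_rfl hj.le hc)]
    exact T.row_weak hj (h hc)
  col_strict' {i1 i2 j} hi hc := by
    rw [if_pos hc, if_pos (ν.up_left_mem hi.le le_rfl hc)]
    exact T.col_strict hi (h hc)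
  zeros' hc := if_neg hc

theorem SemistandardYoungTableau.restrict_apply (T : SemistandardYoungTableau μ) (h : ν ≤ μ)
    (i j : ℕ) : T.restrict h i j = if (i, j) ∈ ν then T i j else 0 := rfl

/-- The extension of a tableau by entries `m` in a horizontal strip. -/
def BoundedSSYT.extend (T : BoundedSSYT ν m) (h : IsHorizontalStrip μ ν) :
    SemistandardYoungTableau μ where
  entry i j := if (i, j) ∈ ν then T.1 i j else if (i, j) ∈ μ then m else 0
  row_weak' {i j1 j2} hj hc := by
    by_cases h2 : (i, j2) ∈ ν
    · rw [if_pos h2, if_pos (ν.up_left_mem le_rfl hj.le h2)]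
      exact T.1.row_weak hj h2
    · rw [if_neg h2, if_pos hc]
      by_cases h1 : (i, j1) ∈ ν
      · rw [if_pos h1]
        exact (T.2 (i, j1) ((YoungDiagram.mem_cells _).2 h1)).le
      · rw [if_neg h1]
        split_ifs <;> omega
  col_strict' {i1 i2 j} hi hc := by
    have h1 : (i1, j) ∈ ν := by
      rw [YoungDiagram.mem_iff_lt_rowLen] at hc ⊢
      exact hc.trans_le ((μ.rowLen_anti _ _ hi).trans (h.2 i1))
    rw [if_pos h1]
    by_cases h2 : (i2, j) ∈ ν
    · rw [if_pos h2]; exact T.1.col_strict hi h2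
    · rw [if_neg h2, if_pos hc]
      exact T.2 (i1, j) ((YoungDiagram.mem_cells _).2 h1)
  zeros' {i j} hc := by rw [if_neg fun h' => hc (h.1 h'), if_neg hc]

theorem BoundedSSYT.extend_apply (T : BoundedSSYT ν m) (h : IsHorizontalStrip μ ν)
    (i j : ℕ) : T.extend h i j = if (i, j) ∈ ν then T.1 i j else if (i, j) ∈ μ then m else 0 := rfl

theorem BoundedSSYT.innerShape_extend (T : BoundedSSYT ν m) (h : IsHorizontalStrip μ ν) :
    innerShape m (T.extend h) = ν := by
  ext ⟨i, j⟩
  rw [YoungDiagram.mem_cells, YoungDiagram.mem_cells, mem_innerShape]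
  simp only [BoundedSSYT.extend_apply]
  by_cases h1 : (i, j) ∈ ν
  · simp only [h1, if_true, iff_true]
    exact ⟨h.1 h1, T.2 (i, j) ((YoungDiagram.mem_cells _).2 h1)⟩
  · simp only [h1, if_false, iff_false]
    rintro ⟨h2, h3⟩
    rw [if_pos h2] at h3
    exact lt_irrefl _ h3

/-- Tableaux with a given inner shape are tableaux of that shape. -/
def innerShapeEquiv (h : IsHorizontalStrip μ ν) :
    {T : BoundedSSYT μ (m + 1) // innerShape m T.1 = ν} ≃ BoundedSSYT ν m where
  toFun T := ⟨T.1.1.restrict h.1, fun c hc => by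
    have hc' : c ∈ innerShape m T.1.1 := by rw [T.2]; exact (YoungDiagram.mem_cells c).1 hc
    rw [SemistandardYoungTableau.restrict_apply, if_pos ((YoungDiagram.mem_cells c).1 hc)]
    exact (mem_innerShape.1 hc').2⟩
  invFun T := ⟨⟨T.extend h, fun c hc => by
    rw [BoundedSSYT.extend_apply]
    split_ifs with h1
    · exact (T.2 c ((YoungDiagram.mem_cells c).2 h1)).trans (Nat.lt_succ_self m)
    · exact Nat.lt_succ_self m
    · exact Nat.succ_pos m⟩, T.innerShape_extend h⟩
  left_inv T := by
    apply Subtype.ext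
    apply Subtype.ext
    ext i j
    simp only [BoundedSSYT.extend_apply, SemistandardYoungTableau.restrict_apply]
    have hmem := mem_innerShape (T := T.1.1) (m := m) (c := (i, j))
    rw [T.2] at hmem
    by_cases h1 : (i, j) ∈ ν
    · simp [h1]
    · by_cases h2 : (i, j) ∈ μ
      · have h3 := T.1.2 (i, j) ((YoungDiagram.mem_cells _).2 h2)
        have h4 : ¬ T.1.1 i j < m := fun h => h1 (hmem.2 ⟨h2, h⟩)
        simp only at h3
        simp only [h1, h2, if_false, if_true]
        omega
      · simp only [h1, h2, if_false]
        exact (T.1.1.zeros h2).symm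
  right_inv T := by
    apply Subtype.ext
    ext i j
    simp only [BoundedSSYT.extend_apply, SemistandardYoungTableau.restrict_apply]
    by_cases h1 : (i, j) ∈ ν
    · simp [h1]
    · simp only [h1, if_false]
      exact (T.1.zeros h1).symm

/-- Contents i - j run backwards along a row. This is why patterns record i + 1 - `rowLen` i: strips
become intervals, and the interlacing of row lengths becomes α i ≤ β i < α (i + 1). -/
theorem prod_Ico_eq_intervalProd (a : ZMod n → K) (i p q : ℕ) :
    ∏ j ∈ Ico p q, a ((i : ZMod n) - (j : ZMod n)) =
      intervalProd a ((i : ℤ) + 1 - q) ((i : ℤ) + 1 - p) := by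
  refine Finset.prod_nbij (fun j : ℕ => (i : ℤ) - j) ?_ ?_ ?_ ?_
  · intro j hj; simp at hj ⊢; omega
  · intro j _ j' _ h; simp at h; exact h
  · intro k hk
    simp at hk
    exact ⟨((i : ℤ) - k).toNat, by simp; omega, by simp; omega⟩
  · intro j _; simp

theorem tableauWeight_extend (x : ℕ → ZMod n → K) (T : BoundedSSYT ν m)
    (h : IsHorizontalStrip μ ν) {M : ℕ} (hM : μ.rowLen M = 0) :
    tableauWeight x μ (T.extend h) =
      (∏ i ∈ range M, intervalProd (x m) ((i : ℤ) + 1 - μ.rowLen i) ((i : ℤ) + 1 - ν.rowLen i)) *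
        tableauWeight x ν T.1 := by
  have hsub : ν.cells ⊆ μ.cells := YoungDiagram.cells_subset_iff.2 h.1
  rw [tableauWeight, ← Finset.prod_sdiff hsub]
  congr 1
  · simp only [← prod_Ico_eq_intervalProd]
    rw [Finset.prod_sigma']
    refine Finset.prod_nbij' (fun c : ℕ × ℕ => (⟨c.1, c.2⟩ : Σ _ : ℕ, ℕ)) (fun c => (c.1, c.2))
      ?_ ?_ (fun _ _ => rfl) (fun _ _ => rfl) ?_
    · rintro ⟨i, j⟩ hc
      simp only [mem_sdiff, YoungDiagram.mem_cells, YoungDiagram.mem_iff_lt_rowLen, mem_sigma,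
        mem_range, mem_Ico] at hc ⊢
      refine ⟨?_, by omega⟩
      by_contra hlt
      have := μ.rowLen_anti M i (by omega)
      omega
    · rintro ⟨i, j⟩ hc
      simp only [mem_sdiff, YoungDiagram.mem_cells, YoungDiagram.mem_iff_lt_rowLen, mem_sigma,
        mem_range, mem_Ico] at hc ⊢
      omega
    · rintro ⟨i, j⟩ hc
      simp only [mem_sdiff, YoungDiagram.mem_cells] at hc
      simp only [BoundedSSYT.extend_apply, if_neg hc.2, if_pos hc.1]
  · refine Finset.prod_congr rfl fun c hc => ?_
    rw [BoundedSSYT.extend_apply, if_pos ((YoungDiagram.mem_cells c).1 hc)]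

/-- Every interlacing β comes from a shape: the bounds make i + 1 - β i nonnegative, weakly
decreasing in i and at most the row length of μ. -/
theorem exists_rowLen_eq {α : Fin (m + 1) → ℤ} (hα : ∀ i, α i = (i : ℤ) + 1 - μ.rowLen i)
    (hμ : μ.rowLen (m + 1) = 0)
    {β : Fin m → ℤ} (hβ : ∀ i : Fin m, α i.castSucc ≤ β i ∧ β i < α i.succ) :
    ∃ ν, IsHorizontalStrip μ ν ∧ (∀ i : Fin m, (ν.rowLen i : ℤ) = (i : ℤ) + 1 - β i) ∧
      ν.rowLen m = 0 := by
  let ν : YoungDiagram :=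
    { cells := μ.cells.filter fun c => ∃ h : c.1 < m, (c.2 : ℤ) < (c.1 : ℤ) + 1 - β ⟨c.1, h⟩
      isLowerSet := by
        rintro ⟨i, j⟩ ⟨i', j'⟩ hle h
        simp only [Finset.coe_filter, YoungDiagram.mem_cells, Set.mem_ofPred_eq] at h ⊢
        obtain ⟨hi, hj⟩ : i' ≤ i ∧ j' ≤ j := hle
        obtain ⟨hc, hlt, hjlt⟩ := h
        refine ⟨μ.up_left_mem hi hj hc, hi.trans_lt hlt, ?_⟩
        rcases hi.eq_or_lt with rfl | hi'
        · omega
        · have h1 := (hβ ⟨i', hi.trans_lt hlt⟩).2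
          have h2 := (hβ ⟨i, hlt⟩).1
          have h3 := μ.rowLen_anti (i' + 1) i hi'
          rw [hα] at h1 h2
          simp only [Fin.val_succ, Fin.val_castSucc, Nat.cast_add, Nat.cast_one] at h1 h2
          omega }
  have hmem : ∀ i j, (i, j) ∈ ν ↔
      (i, j) ∈ μ ∧ ∃ h : i < m, (j : ℤ) < (i : ℤ) + 1 - β ⟨i, h⟩ := by
    intro i j
    rw [← YoungDiagram.mem_cells, Finset.mem_filter, YoungDiagram.mem_cells]
  have hrow : ∀ i : Fin m, (ν.rowLen i : ℤ) = (i : ℤ) + 1 - β i := by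
    intro i
    have h1 := (hβ i).1
    have h2 := (hβ i).2
    rw [hα] at h1 h2
    simp only [Fin.val_succ, Fin.val_castSucc, Nat.cast_add, Nat.cast_one] at h1 h2
    have key : ∀ j : ℕ, j < ν.rowLen i ↔ (j : ℤ) < (i : ℤ) + 1 - β i := by
      intro j
      rw [← YoungDiagram.mem_iff_lt_rowLen, hmem, YoungDiagram.mem_iff_lt_rowLen]
      constructor
      · rintro ⟨_, _, h⟩; exact h
      · intro h; exact ⟨by omega, i.2, h⟩
    apply le_antisymm
    · by_contra hlt
      have := (key ((i : ℤ) + 1 - β i).toNat).1 (by omega)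
      omega
    · by_contra hlt
      have := (key (ν.rowLen i)).2 (by omega)
      omega
  have hm : ν.rowLen m = 0 := by
    by_contra h
    have h1 : (m, 0) ∈ ν := YoungDiagram.mem_iff_lt_rowLen.2 (Nat.pos_of_ne_zero h)
    obtain ⟨_, h2, _⟩ := (hmem m 0).1 h1
    exact lt_irrefl _ h2
  refine ⟨ν, ⟨fun c hc => ((hmem c.1 c.2).1 hc).1, fun i => ?_⟩, hrow, hm⟩
  by_cases hi : i < m
  · have h1 := hrow ⟨i, hi⟩
    have h2 := (hβ ⟨i, hi⟩).2
    rw [hα] at h2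
    simp only [Fin.val_succ, Nat.cast_add, Nat.cast_one] at h1 h2
    omega
  · have := μ.rowLen_anti (m + 1) (i + 1) (by omega)
    omega

theorem rowLen_eq_zero_of_le {M i : ℕ} (h : μ.rowLen M = 0) (hi : M ≤ i) : μ.rowLen i = 0 :=
  Nat.le_zero.1 (h ▸ μ.rowLen_anti M i hi)

/-- The largest entry m fills a horizontal strip, so grouping tableaux by `innerShape` reproduces
the recursion of `gtSum`. The hypothesis allows at most m rows, as column strictness demands. -/
theorem sum_tableauWeight_eq_gtSum (x : ℕ → ZMod n → K) :
    ∀ (m : ℕ) {μ : YoungDiagram}, μ.rowLen m = 0 →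
      ∑ T : BoundedSSYT μ m, tableauWeight x μ T.1 =
        gtSum x m fun i => (i : ℤ) + 1 - μ.rowLen i := by
  intro m
  induction m with
  | zero =>
    intro μ hμ
    have hempty : μ = ⊥ := by
      ext ⟨i, j⟩
      rw [YoungDiagram.mem_cells, YoungDiagram.mem_iff_lt_rowLen,
        rowLen_eq_zero_of_le hμ (Nat.zero_le i)]
      simp
    subst hempty
    have hT : ∀ T : BoundedSSYT ⊥ 0,
        T = ⟨SemistandardYoungTableau.highestWeight ⊥, fun c hc => by simp at hc⟩ := by
      intro T
      apply Subtype.ext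
      ext i j
      rw [T.1.zeros (YoungDiagram.notMem_bot _),
        (SemistandardYoungTableau.highestWeight ⊥).zeros (YoungDiagram.notMem_bot _)]
    rw [Fintype.sum_eq_single _ fun T hne => absurd (hT T) hne]
    simp [tableauWeight, gtSum]
  | succ m ih =>
    classical
    intro μ hμ
    rw [gtSum]
    set α : Fin (m + 1) → ℤ := fun i => (i : ℤ) + 1 - μ.rowLen i with hα
    set pat : BoundedSSYT μ (m + 1) → Fin m → ℤ :=
      fun T i => (i : ℤ) + 1 - (innerShape m T.1).rowLen i with hpat
    have hmaps : ∀ T ∈ (univ : Finset (BoundedSSYT μ (m + 1))),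
        pat T ∈ Fintype.piFinset fun i : Fin m => Ico (α i.castSucc) (α i.succ) := by
      intro T _
      rw [Fintype.mem_piFinset]
      intro i
      have hs := isHorizontalStrip_innerShape T
      have h1 := hs.2 i
      have h2 := rowLen_le_of_le hs.1 i
      simp only [hα, hpat, mem_Ico, Fin.val_succ, Fin.val_castSucc, Nat.cast_add, Nat.cast_one]
      omega
    rw [← Finset.sum_fiberwise_of_maps_to hmaps]
    refine Finset.sum_congr rfl fun β hβ => ?_
    have hβ' : ∀ i : Fin m, α i.castSucc ≤ β i ∧ β i < α i.succ := fun i =>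
      Finset.mem_Ico.1 (Fintype.mem_piFinset.1 hβ i)
    obtain ⟨ν, hstrip, hrow, hνm⟩ := exists_rowLen_eq (μ := μ) (fun _ => rfl) hμ hβ'
    have hfiber : ∀ T : BoundedSSYT μ (m + 1), pat T = β ↔ innerShape m T.1 = ν := by
      intro T
      constructor
      · intro h
        apply eq_of_rowLen_eq
        intro i
        rcases lt_or_ge i m with hi | hi
        · have h1 := congrFun h ⟨i, hi⟩
          have h2 := hrow ⟨i, hi⟩
          simp only [hpat] at h1 h2
          omega
        · rw [rowLen_eq_zero_of_le (rowLen_innerShape_self T.1) hi, rowLen_eq_zero_of_le hνm hi]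
      · intro h
        funext i
        have h2 := hrow i
        simp only [hpat, h]
        omega
    have hβν : (fun i : Fin m => (i : ℤ) + 1 - ν.rowLen i) = β := by
      funext i
      have := hrow i
      omega
    rw [← hβν, ← ih hνm, Finset.mul_sum]
    simp only [hβν, hfiber]
    rw [← Finset.sum_subtype_eq_sum_filter, Finset.subtype_univ,
      ← Equiv.sum_comp (innerShapeEquiv (m := m) hstrip).symm]
    refine Finset.sum_congr rfl fun T _ => ?_
    change tableauWeight x μ (T.extend hstrip) = _
    -- Row m is empty in ν, so its factor runs up to m + 1 and is the separate last factor of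
    -- `gtSum`.
    rw [tableauWeight_extend x T hstrip hμ, Finset.prod_range_succ, hνm,
      ← Fin.prod_univ_eq_prod_range (fun i => intervalProd (x m) ((i : ℤ) + 1 - μ.rowLen i)
        ((i : ℤ) + 1 - ν.rowLen i))]
    congr 2

end Tableaux

/-! ### Orders of magnitude -/

section Order

variable {K : Type*} [Field K] [LinearOrder K] [IsStrictOrderedRing K] {ε : K}

/-- `F` is of the order of magnitude of `ε ^ k`. -/
def HasOrder (ε F : K) (k : ℤ) : Prop := ∃ N : ℕ, F ≤ N * ε ^ k ∧ ε ^ k ≤ N * F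

theorem HasOrder.pos (hε : 0 < ε) {F : K} {k : ℤ} (h : HasOrder ε F k) : 0 < F := by
  obtain ⟨N, _, h2⟩ := h
  exact pos_of_mul_pos_right ((zpow_pos hε k).trans_le h2) (Nat.cast_nonneg N)

theorem hasOrder_zpow (ε : K) (k : ℤ) : HasOrder ε (ε ^ k) k := ⟨1, by simp⟩

theorem hasOrder_one (ε : K) : HasOrder ε 1 0 := by simpa using hasOrder_zpow ε 0

theorem hasOrder_natCast {c : ℕ} (hc : 0 < c) : HasOrder ε (c : K) 0 := by
  refine ⟨c, by simp, ?_⟩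
  have : (1 : K) ≤ c := by exact_mod_cast hc
  simpa using one_le_mul_of_one_le_of_one_le this this

theorem HasOrder.mul (hε : 0 < ε) {F G : K} {k l : ℤ} (hF : HasOrder ε F k)
    (hG : HasOrder ε G l) : HasOrder ε (F * G) (k + l) := by
  have hF0 := hF.pos hε
  have hG0 := hG.pos hε
  obtain ⟨N, h1, h2⟩ := hF
  obtain ⟨M, h3, h4⟩ := hG
  have hk := zpow_pos hε k
  have hl := zpow_pos hε l
  refine ⟨N * M, ?_, ?_⟩
  · rw [zpow_add₀ hε.ne', Nat.cast_mul, mul_mul_mul_comm]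
    exact mul_le_mul h1 h3 hG0.le (by positivity)
  · rw [zpow_add₀ hε.ne', Nat.cast_mul, mul_mul_mul_comm]
    exact mul_le_mul h2 h4 hl.le (by positivity)

theorem HasOrder.inv (hε : 0 < ε) {F : K} {k : ℤ} (hF : HasOrder ε F k) :
    HasOrder ε F⁻¹ (-k) := by
  have hF0 := hF.pos hε
  obtain ⟨N, h1, h2⟩ := hF
  have hk := zpow_pos hε k
  refine ⟨N, ?_, ?_⟩
  · rw [zpow_neg, ← div_eq_mul_inv, le_div_iff₀ hk, inv_mul_le_iff₀ hF0, mul_comm]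
    exact h2
  · rw [zpow_neg, ← div_eq_mul_inv, le_div_iff₀ hF0, inv_mul_le_iff₀ hk, mul_comm]
    exact h1

theorem HasOrder.div (hε : 0 < ε) {F G : K} {k l : ℤ} (hF : HasOrder ε F k)
    (hG : HasOrder ε G l) : HasOrder ε (F / G) (k - l) := by
  rw [div_eq_mul_inv, sub_eq_add_neg]
  exact hF.mul hε (hG.inv hε)

/-- Elements with an order are positive, so nothing cancels and the smaller exponent dominates. -/
theorem HasOrder.add (hε : 0 < ε) (hε1 : ε ≤ 1) {F G : K} {k l : ℤ} (hF : HasOrder ε F k)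
    (hG : HasOrder ε G l) : HasOrder ε (F + G) (min k l) := by
  have hF0 := hF.pos hε
  have hG0 := hG.pos hε
  obtain ⟨N, h1, h2⟩ := hF
  obtain ⟨M, h3, h4⟩ := hG
  have hN : (0 : K) ≤ N := Nat.cast_nonneg N
  have hM : (0 : K) ≤ M := Nat.cast_nonneg M
  refine ⟨N + M, ?_, ?_⟩
  · have hk : ε ^ k ≤ ε ^ min k l := zpow_le_zpow_right_of_le_one₀ hε hε1 (min_le_left k l)
    have hl : ε ^ l ≤ ε ^ min k l := zpow_le_zpow_right_of_le_one₀ hε hε1 (min_le_right k l)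
    rw [Nat.cast_add, add_mul]
    exact add_le_add (h1.trans (mul_le_mul_of_nonneg_left hk hN))
      (h3.trans (mul_le_mul_of_nonneg_left hl hM))
  · rw [Nat.cast_add]
    rcases min_choice k l with h | h <;> rw [h]
    · exact h2.trans (mul_le_mul (by linarith) (by linarith) hF0.le (by linarith))
    · exact h4.trans (mul_le_mul (by linarith) (by linarith) hG0.le (by linarith))

/-- Different powers of an infinitesimal cannot be compared up to natural multiples, so the exponent
is determined. -/
theorem HasOrder.le_of_infinitesimal (hε : 0 < ε) (hinf : ∀ N : ℕ, N * ε < 1) {F : K} {k l : ℤ}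
    (hk : HasOrder ε F k) (hl : HasOrder ε F l) : k ≤ l := by
  have hε1 : ε ≤ 1 := by simpa using (hinf 1).le
  obtain ⟨N, h1, _⟩ := hk
  obtain ⟨M, _, h4⟩ := hl
  by_contra hlt
  push Not at hlt
  have hM : (0 : K) ≤ M := Nat.cast_nonneg M
  have hpos := zpow_pos hε l
  have h5 : ε ^ k ≤ ε * ε ^ l := by
    rw [← zpow_one_add₀ hε.ne']
    exact zpow_le_zpow_right_of_le_one₀ hε hε1 (by omega)
  have h6 : ε ^ l ≤ (M * N : ℕ) * ε * ε ^ l := by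
    calc ε ^ l ≤ M * F := h4
      _ ≤ M * (N * (ε * ε ^ l)) := by gcongr; exact h1.trans (by gcongr)
      _ = (M * N : ℕ) * ε * ε ^ l := by push_cast; ring
  have h7 := mul_lt_mul_of_pos_right (hinf (M * N)) hpos
  linarith

theorem HasOrder.unique (hε : 0 < ε) (hinf : ∀ N : ℕ, N * ε < 1) {F : K} {k l : ℤ}
    (hk : HasOrder ε F k) (hl : HasOrder ε F l) : k = l :=
  le_antisymm (hk.le_of_infinitesimal hε hinf hl) (hl.le_of_infinitesimal hε hinf hk)

theorem HasOrder.prod (hε : 0 < ε) {ι : Type*} (s : Finset ι) {F : ι → K} {k : ι → ℤ}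
    (h : ∀ i ∈ s, HasOrder ε (F i) (k i)) : HasOrder ε (∏ i ∈ s, F i) (∑ i ∈ s, k i) := by
  classical
  induction s using Finset.induction_on with
  | empty => simpa using hasOrder_one ε
  | insert i s hi ih =>
    rw [Finset.prod_insert hi, Finset.sum_insert hi]
    exact (h i (by simp)).mul hε (ih fun j hj => h j (by simp [hj]))

theorem HasOrder.sum_inf' (hε : 0 < ε) (hε1 : ε ≤ 1) {ι : Type*} {s : Finset ι}
    (hs : s.Nonempty) {F : ι → K} {k : ι → ℕ} (h : ∀ i ∈ s, HasOrder ε (F i) (k i)) :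
    HasOrder ε (∑ i ∈ s, F i) (s.inf' hs k : ℕ) := by
  classical
  induction hs using Finset.Nonempty.cons_induction with
  | singleton i => simpa using h i (by simp)
  | cons i s hi hs ih =>
    rw [Finset.sum_cons, Finset.inf'_cons hs, Nat.cast_min]
    exact (h i (by simp)).add hε hε1 (ih fun j hj => h j (by simp [hj]))

/-- `a` is the order of magnitude of `F`, with `0` corresponding to the tropical zero. -/
def HasTropOrder (ε F : K) (a : Tropical (WithTop ℤ)) : Prop :=
  (F = 0 ∧ a = 0) ∨ ∃ k : ℤ, a = Tropical.trop (k : WithTop ℤ) ∧ HasOrder ε F k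

theorem HasTropOrder.add (hε : 0 < ε) (hε1 : ε ≤ 1) {F G : K} {a b : Tropical (WithTop ℤ)}
    (hF : HasTropOrder ε F a) (hG : HasTropOrder ε G b) : HasTropOrder ε (F + G) (a + b) := by
  rcases hF with ⟨rfl, rfl⟩ | ⟨k, rfl, hk⟩
  · simpa using hG
  rcases hG with ⟨rfl, rfl⟩ | ⟨l, rfl, hl⟩
  · rw [add_zero, add_zero]
    exact Or.inr ⟨k, rfl, hk⟩
  exact Or.inr ⟨min k l, by rw [WithTop.coe_min]; rfl, hk.add hε hε1 hl⟩

theorem HasTropOrder.sum (hε : 0 < ε) (hε1 : ε ≤ 1) {ι : Type*} (s : Finset ι) {F : ι → K}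
    {a : ι → Tropical (WithTop ℤ)} (h : ∀ i ∈ s, HasTropOrder ε (F i) (a i)) :
    HasTropOrder ε (∑ i ∈ s, F i) (∑ i ∈ s, a i) := by
  classical
  induction s using Finset.induction_on with
  | empty => exact Or.inl ⟨rfl, rfl⟩
  | insert i s hi ih =>
    rw [Finset.sum_insert hi, Finset.sum_insert hi]
    exact (h i (by simp)).add hε hε1 (ih fun j hj => h j (by simp [hj]))

theorem HasOrder.hasTropOrder_prod (hε : 0 < ε) {ι : Type*} (s : Finset ι) {F : ι → K} {k : ι → ℤ}
    (h : ∀ i ∈ s, HasOrder ε (F i) (k i)) :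
    HasTropOrder ε (∏ i ∈ s, F i) (∏ i ∈ s, Tropical.trop ((k i : ℤ) : WithTop ℤ)) := by
  refine Or.inr ⟨∑ i ∈ s, k i, ?_, HasOrder.prod hε s h⟩
  rw [WithTop.coe_sum, trop_sum]

theorem HasTropOrder.eq_trop (hε : 0 < ε) (hinf : ∀ N : ℕ, N * ε < 1) {F : K}
    {a : Tropical (WithTop ℤ)} {k : ℤ} (h : HasTropOrder ε F a) (hk : HasOrder ε F k) :
    a = Tropical.trop (k : WithTop ℤ) := by
  rcases h with ⟨rfl, _⟩ | ⟨l, rfl, hl⟩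
  · exact absurd (hk.pos hε) (lt_irrefl _)
  · rw [hl.unique hε hinf hk]

end Order

/-! ### Tropicalization of the birational `R`-matrix -/

section Tropicalization

variable {n : ℕ} [NeZero n] {K : Type*} [Field K] [LinearOrder K] [IsStrictOrderedRing K] {ε : K}

/-- The entries of `a` have the numbers of letters in `y`, shifted by `τ`, as orders of
magnitude. -/
def RowHasOrder (ε : K) (a : ZMod n → K) (y : ZMod n → ℕ) (τ : ZMod n) : Prop :=
  ∀ k, HasOrder ε (a k) (y (k - τ))

/-- The shift τ is the position of a row. As b stands one step further right, the residue k + t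
means a letter of y one higher than the corresponding letter of z, which is the offset in
`RowSlide.term`. -/
theorem RowHasOrder.geomSlide (hε : 0 < ε) (hε1 : ε ≤ 1) {a b : ZMod n → K} {y z : ZMod n → ℕ}
    {τ : ZMod n} (ha : RowHasOrder ε a y τ) (hb : RowHasOrder ε b z (τ + 1)) (k : ZMod n) :
    HasOrder ε (geomSlide a b k) (RowSlide.slide y z (k - τ - 1)) := by
  refine HasOrder.sum_inf' hε hε1 _ fun s _ => ?_
  rw [RowSlide.term]
  push_cast
  refine (HasOrder.prod hε _ fun t _ => ?_).mul hε (HasOrder.prod hε _ fun t _ => ?_)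
  · have h := hb (k + t)
    rwa [show k + t - (τ + 1) = k - τ - 1 + t by ring] at h
  · have h := ha (k + t)
    rwa [show k + t - τ = k - τ - 1 + 1 + t by ring] at h

theorem RowHasOrder.geomMoved (hn : 1 < n) (hε : 0 < ε) (hε1 : ε ≤ 1) {a b : ZMod n → K}
    {y z : ZMod n → ℕ} {τ : ZMod n} (ha : RowHasOrder ε a y τ) (hb : RowHasOrder ε b z (τ + 1)) :
    RowHasOrder ε (geomMoved a b) (RowSlide.moved y z) (τ + 1) := by
  intro k
  have h := ((ha (k - 1)).mul hε (ha.geomSlide hε hε1 hb k)).div hε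
    (ha.geomSlide hε hε1 hb (k + 1))
  have e1 : k - 1 - τ = k - (τ + 1) := by ring
  have e2 : k - τ - 1 = k - (τ + 1) := by ring
  have e3 : k + 1 - τ - 1 = k - (τ + 1) + 1 := by ring
  rw [e1, e2, e3] at h
  have := RowSlide.moved_add (y := y) (z := z) hn (k - (τ + 1))
  have e4 : ((RowSlide.moved y z (k - (τ + 1)) : ℕ) : ℤ) = y (k - (τ + 1)) +
      RowSlide.slide y z (k - (τ + 1)) - RowSlide.slide y z (k - (τ + 1) + 1) := by omega
  rw [e4]
  exact h

variable {m : ℕ} {l : Fin m → ℕ}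

/-- A point over the rows `b` in a field with an infinitesimal `ε`. -/
noncomputable def rowLift (ε : K) (b : ∀ i, KRRow n (l i)) (t : ℕ) (r : ZMod n) : K :=
  -- The factor t + 1 has order 0 and separates the row products even for rows of equal length. The
  -- value 1 beyond m keeps all rows positive.
  if h : t < m then (t + 1 : ℕ) * ε ^ (((b ⟨t, h⟩).count (r - t) : ℕ) : ℤ) else 1

theorem rowLift_pos (hε : 0 < ε) (b : ∀ i, KRRow n (l i)) (t : ℕ) (r : ZMod n) :
    0 < rowLift ε b t r := by
  unfold rowLift
  split_ifs
  · have := zpow_pos hε (((b ⟨t, by assumption⟩).count (r - t) : ℕ) : ℤ)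
    positivity
  · exact one_pos

theorem rowHasOrder_rowLift (hε : 0 < ε) (b : ∀ i, KRRow n (l i)) (i : Fin m) :
    RowHasOrder ε (rowLift ε b i) (b i).count ((i : ℕ) : ZMod n) := by
  intro k
  rw [rowLift, dif_pos i.2]
  have h := (hasOrder_natCast (ε := ε) (Nat.succ_pos i)).mul hε
    (hasOrder_zpow ε (((b i).count (k - (i : ℕ)) : ℕ) : ℤ))
  rwa [zero_add] at h

/-- Equal products would have equal orders, hence equal row lengths; then the constants (t + 1) ^ n
differ. -/
theorem prod_rowLift_ne (hε : 0 < ε) (hinf : ∀ N : ℕ, N * ε < 1) (b : ∀ i, KRRow n (l i))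
    {i j : ℕ} (hij : i < j) (hj : j < m) : ∏ r, rowLift ε b i r ≠ ∏ r, rowLift ε b j r := by
  have key : ∀ (t : ℕ) (ht : t < m),
      ∏ r, rowLift ε b t r = ((t + 1) ^ n : ℕ) * ε ^ ((l ⟨t, ht⟩ : ℕ) : ℤ) := by
    intro t ht
    have hsum : ∑ r : ZMod n, (b ⟨t, ht⟩).count (r - t) = l ⟨t, ht⟩ :=
      (Equiv.sum_comp (Equiv.subRight (t : ZMod n)) (b ⟨t, ht⟩).count).trans
        (b ⟨t, ht⟩).sum_count
    simp only [rowLift, dif_pos ht, zpow_natCast]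
    rw [Finset.prod_mul_distrib, Finset.prod_pow_eq_pow_sum, hsum, Finset.prod_const,
      Finset.card_univ, ZMod.card]
    push_cast
    rfl
  rw [key i (hij.trans hj), key j hj]
  intro h
  have hord : ∀ (t : ℕ) (ht : t < m),
      HasOrder ε (((t + 1) ^ n : ℕ) * ε ^ ((l ⟨t, ht⟩ : ℕ) : ℤ)) (l ⟨t, ht⟩) := by
    intro t ht
    simpa using (hasOrder_natCast (ε := ε) (c := (t + 1) ^ n) (by positivity)).mul hε
      (hasOrder_zpow ε (l ⟨t, ht⟩))
  have h1 := hord i (hij.trans hj)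
  have hl := h1.unique hε hinf (h ▸ hord j hj)
  rw [hl] at h
  have h2 := mul_right_cancel₀ (zpow_pos hε _).ne' h
  have h3 : (i + 1) ^ n = (j + 1) ^ n := by exact_mod_cast h2
  have := Nat.pow_left_injective (NeZero.ne n) h3
  omega

theorem rowHasOrder_geomMoveRight (hn : 1 < n) (hε : 0 < ε) (hε1 : ε ≤ 1)
    (b : ∀ i, KRRow n (l i)) (i : Fin m) (d : ℕ) (h : (i : ℕ) + d < m) :
    RowHasOrder ε (geomMoveRight (rowLift ε b) i d) (moveRight b i d h).count
      ((i + d : ℕ) : ZMod n) := by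
  induction d with
  | zero => exact rowHasOrder_rowLift hε b i
  | succ d ih =>
    have h1 := ih (by omega)
    have h2 := rowHasOrder_rowLift hε b ⟨i + (d + 1), h⟩
    have e : ((i + (d + 1) : ℕ) : ZMod n) = ((i + d : ℕ) : ZMod n) + 1 := by push_cast; ring
    rw [moveRight, combR_eq_rowSwap hn, e]
    rw [e] at h2
    exact h1.geomMoved hn hε hε1 h2

theorem hasOrder_prod_geomSlide (hn : 1 < n) (hε : 0 < ε) (hε1 : ε ≤ 1)
    (b : ∀ i, KRRow n (l i)) :
    HasOrder ε (∏ t ∈ range m, ∏ j ∈ range t,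
        geomSlide (geomMoveRight (rowLift ε b) j (t - 1 - j)) (rowLift ε b t) ((t : ZMod n) + 1))
      (intrinsicEnergy b) := by
  rw [prod_range_range_eq_prod_fin]
  refine HasOrder.prod hε _ fun i _ => HasOrder.prod hε _ fun j _ => ?_
  split_ifs with hij
  · have hij' : (i : ℕ) < j := hij
    rw [localCoenergy_eq_slide hn]
    have h1 := rowHasOrder_geomMoveRight hn hε hε1 b i ((j : ℕ) - 1 - i) (by omega)
    have h2 := rowHasOrder_rowLift hε b j
    have e : ((j : ℕ) : ZMod n) = ((i + ((j : ℕ) - 1 - i) : ℕ) : ZMod n) + 1 := by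
      rw [← Nat.cast_succ]
      congr 1
      omega
    rw [e] at h2
    have h3 := h1.geomSlide hε hε1 h2 (((j : ℕ) : ZMod n) + 1)
    -- The base point j + 1 of the birational slide becomes the letter 1, the base of the coenergy.
    rw [show ((j : ℕ) : ZMod n) + 1 - ((i + ((j : ℕ) - 1 - i) : ℕ) : ZMod n) - 1 = 1 by
      rw [e]; ring] at h3
    exact h3
  · exact hasOrder_one ε

end Tropicalization

/-! ### The staircase shape and the comparison of the two orders. -/

theorem rowLen_stretchedStaircase (k t i : ℕ) :
    (stretchedStaircase k t).rowLen i = k * (t - i) := by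
  have key : ∀ j, j < (stretchedStaircase k t).rowLen i ↔ j < k * (t - i) := by
    intro j
    rw [← YoungDiagram.mem_iff_lt_rowLen, stretchedStaircase, YoungDiagram.mem_ofRowLens]
    constructor
    · rintro ⟨h, h'⟩
      simpa using h'
    · intro h
      have hi : i < t := by
        by_contra hlt
        rw [Nat.sub_eq_zero_of_le (not_lt.1 hlt)] at h
        simp at h
      exact ⟨by simpa using hi, by simpa using h⟩
  exact le_antisymm (not_lt.1 fun h => lt_irrefl _ ((key _).1 h))
    (not_lt.1 fun h => lt_irrefl _ ((key _).2 h))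

theorem hasTropOrder_tropicalization {n : ℕ} [NeZero n] {K : Type*} [Field K] [LinearOrder K]
    [IsStrictOrderedRing K] {ε : K} (hε : 0 < ε) (hε1 : ε ≤ 1) {m : ℕ} {l : Fin m → ℕ}
    (b : ∀ i, KRRow n (l i)) (μ : YoungDiagram) :
    HasTropOrder ε (∑ T : BoundedSSYT μ m, tableauWeight (rowLift ε b) μ T.1)
      (Tropical.trop (tropicalization (loopSchur n m 0 μ)
        fun v => ((b v.1).count (v.2 - ((v.1 : ℕ) : ZMod n)) : ℤ))) := by
  rw [tropicalization, Tropical.trop_untrop, loopSchur, MvPolynomial.eval₂_sum]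
  refine HasTropOrder.sum hε hε1 _ fun T _ => ?_
  rw [MvPolynomial.eval₂_prod, tableauWeight, ← Finset.prod_coe_sort]
  simp only [MvPolynomial.eval₂_X, add_zero]
  refine HasOrder.hasTropOrder_prod hε _ fun c _ => ?_
  exact rowHasOrder_rowLift hε b ⟨T.1 c.1.1 c.1.2, T.2 c.1 c.2⟩ _

theorem theorem2 (n : ℕ) [NeZero n] (hn : 1 < n) (m : ℕ) (l : Fin m → ℕ)
    (b : ∀ i, KRRow n (l i)) :
    ((intrinsicEnergy b : ℤ) : WithTop ℤ) =
      tropicalization (loopSchur n m 0 (stretchedStaircase (n - 1) (m - 1)))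
        (fun v : Fin m × ZMod n => ((b v.1).count (v.2 - ((v.1 : ℕ) : ZMod n)) : ℤ)) := by
  -- The hyperreals serve as an ordered field with an infinitesimal.
  have hε : (0 : ℝ*) < Hyperreal.epsilon := Hyperreal.epsilon_pos
  have hinf : ∀ N : ℕ, (N : ℝ*) * Hyperreal.epsilon < 1 := by
    intro N
    have h : Hyperreal.epsilon < (((N + 1 : ℕ) : ℝ)⁻¹ : ℝ) :=
      Hyperreal.epsilon_lt_of_pos (by positivity)
    have h' : ((N + 1 : ℕ) : ℝ*) * Hyperreal.epsilon < 1 := by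
      rw [mul_comm, ← lt_div_iff₀ (by positivity), one_div]
      push_cast at h ⊢
      exact h
    push_cast at h'
    linarith
  have hε1 : (Hyperreal.epsilon : ℝ*) ≤ 1 := by simpa using (hinf 1).le
  have hS := hasTropOrder_tropicalization hε hε1 b (stretchedStaircase (n - 1) (m - 1))
  -- Row lengths (n - 1)(m - 1 - i) are exactly those that space the points i + 1 - `rowLen` i by n,
  -- as the Vandermonde evaluation requires.
  have hα : (fun i : Fin m => (i : ℤ) + 1 - (stretchedStaircase (n - 1) (m - 1)).rowLen i) =
      fun i : Fin m => (m : ℤ) - n * (m - 1 - (i : ℕ) : ℕ) := by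
    funext i
    rw [rowLen_stretchedStaircase]
    have h1 : (i : ℤ) + 1 = m - (m - 1 - i : ℕ) := by omega
    rw [h1]
    push_cast [Nat.cast_sub hn.le]
    ring
  rw [sum_tableauWeight_eq_gtSum _ m (by rw [rowLen_stretchedStaircase]; simp), hα,
    gtSum_eq_prod_geomSlide (rowLift_pos hε b) m
      fun i j hij hj => prod_rowLift_ne hε hinf b hij hj] at hS
  exact (Tropical.trop_injective
    (hS.eq_trop hε hinf (hasOrder_prod_geomSlide hn hε hε1 b))).symm
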